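/- \textbf{Setting.} Let $d\ge 1$, let $\mathcal H,\mathfrak H$ be complex Hilbert spaces, $\Pi:\mathcal H\to L^2(\mathbb R^d,\mathfrak H)$ a unitary, and write $\Phi_P=(\Pi\Phi)(P)$ for $\Phi\in\mathcal H$. Let $(H(P))_{P\in\mathbb R^d}$ be positive self-adjoint (possibly unbounded) operators on $\mathfrak H$, let $H=\Pi^*\big(\int^{\oplus}_{\mathbb R^d}H(P)\,dP\big)\Pi$, let $U(k)$ be the unitary $(U(k)\Phi)_P=\Phi_{P+k}$, and let $E(P)=\inf\operatorname{spec}H(P)$. Assume: 0. For all $P_0\in\mathbb R^d$ and $\xi\notin\operatorname{spec}H(P_0)$ there is a neighbourhood $N$ of $P_0$ such that $\xi\notin\operatorname{spec}H(P)$ for $P\in N$ and $N\ni P\mapsto(H(P)-\xi)^{-1}$ is real analytic in operator norm. 1. $E(P)=E_r(|P|)$ is rotation invariant, its minimal value is $0$, and there are $L\ge 0$ and $0\le Q_0<Q_1<\dots<Q_L$ such that $E(P)=0$ if and only if $|P|\in\{Q_0,\dots,Q_L\}$. Moreover $\liminf_{|P|\to\infty}E(P)>0$. 2. For every $\ell$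 there is a neighbourhood $\Delta_\ell$ of $Q_\ell$ such that $E$ is real analytic on $\tilde M_\ell=\{P:|P|\in\Delta_\ell\}$, and $E_r(Q_\ell+R)\sim c_\ell R^{n_\ell}$ as $R\to0$ ($R\geq 0$ if $Q_\ell=0$), for some $c_\ell\ne0$ and some integer $n_\ell\ge2$. 3. For $P\in\tilde M_\ell$, $E(P)$ is a simple eigenvalue of $H(P)$ with normalized eigenvector $\psi_P$, and $\tilde M_\ell\ni P\mapsto|\psi_P\rangle\langle\psi_P|$ is strongly continuous. A vector $\phi\in\mathcal H$ is called admissible if 4. for every $\ell$, the function $P\mapsto|\langle\phi_P,\psi_P\rangle|$ agrees almost everywhere on $\tilde M_\ell$ with a continuous function that does not vanish on $\{|P|=Q_\ell\}$, and $P\mapsto\|\phi_P\|$ is essentially bounded on $\tilde M_\ell$. For $k\in\mathbb R^d$ and $t,T\ge0$ let $\tilde G_T(k,t)=\langle\phi,e^{-TH}U(k)e^{-tH}U(k)^*e^{-TH}\phi\rangle$ and $G_T(k,t)=\tilde G_T(k,t)/\tilde G_T(0,t)$. \textbf{Theorem.} Suppose that for some admissible $\phi$ and some $\sigma>0$ the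 central limit theorem for two-sided pinning holds, i.e. for all $k\in\mathbb R^d$, $t\ge 0$ the limit $G_\infty(k,t)=\lim_{T\to\infty}G_T(k,t)$ exists and $$\lim_{\epsilon\to0}G_\infty(\epsilon k,\epsilon^{-2}t)=e^{-\frac12\sigma^2k^2t}.$$ Then, for $d\ge2$, $E$ has a global minimum at $P=0$ (that is, $Q_0=0$), $\sigma^2=E_r''(0)$, and $E(P)>E(0)$ for all $P\ne0$. For $d=1$, $\sigma^2=E_r''(Q_\ell)$ for every $\ell=0,1,\dots,L$. (At the boundary point $0$ of $[0,\infty)$, $E_r''(0)$ is the one-sided second derivative.) -/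

import Mathlib

open MeasureTheory Filter Topology Asymptotics
open scoped InnerProductSpace ENNReal

noncomputable section

namespace FiberCLT

/-- Momentum space `ℝᵈ` with its Euclidean norm. -/
abbrev Momentum (d : ℕ) : Type := EuclideanSpace ℝ (Fin d)

section Operators

variable {X : Type*} [NormedAddCommGroup X] [InnerProductSpace ℂ X]

/-- `R` is a bounded two-sided inverse of the unbounded operator `A - ξ`. -/
structure IsResolvent (A : X →ₗ.[ℂ] X) (ξ : ℂ) (R : X →L[ℂ] X) : Prop where
  right_inv : ∀ y : X, ∃ h : R y ∈ A.domain, A ⟨R y, h⟩ - ξ • R y = y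
  left_inv : ∀ x : A.domain, R (A x - ξ • (x : X)) = x

theorem IsResolvent.unique {A : X →ₗ.[ℂ] X} {ξ : ℂ} {R S : X →L[ℂ] X}
    (hR : IsResolvent A ξ R) (hS : IsResolvent A ξ S) : R = S := by
  ext y
  obtain ⟨h, hy⟩ := hS.right_inv y
  have := hR.left_inv ⟨S y, h⟩
  rw [hy] at this
  exact this

/-- The resolvent set of an unbounded operator. -/
def resolventSet (A : X →ₗ.[ℂ] X) : Set ℂ := {ξ | ∃ R : X →L[ℂ] X, IsResolvent A ξ R}

/-- The spectrum of an unbounded operator. -/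
def spec (A : X →ₗ.[ℂ] X) : Set ℂ := (resolventSet A)ᶜ

open Classical in
/-- The bounded operator `(A - ξ)⁻¹` for `ξ` in the resolvent set (and `0` otherwise). -/
def resolvent (A : X →ₗ.[ℂ] X) (ξ : ℂ) : X →L[ℂ] X :=
  if h : ξ ∈ resolventSet A then h.choose else 0

theorem isResolvent_resolvent {A : X →ₗ.[ℂ] X} {ξ : ℂ} (h : ξ ∈ resolventSet A) :
    IsResolvent A ξ (resolvent A ξ) := by
  rw [resolvent, dif_pos h]
  exact h.choose_spec

/-- The bottom `inf spec A` of the (real) spectrum. -/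
def infSpec (A : X →ₗ.[ℂ] X) : ℝ := sInf {x : ℝ | (x : ℂ) ∈ spec A}

/-- `A` is a positive operator: `⟨x, A x⟩ ≥ 0` on the domain. -/
def IsPositiveOp (A : X →ₗ.[ℂ] X) : Prop := ∀ x : A.domain, 0 ≤ (⟪(x : X), A x⟫_ℂ).re

/-- The function `b ↦ exp (-t (1 / b - 1))`, set to be `0` at `b = 0`. With `b = 1 / (1 + a)` it is
`exp (-t a)`; for `t > 0` it is continuous on `[0, 1]`. -/
def heatFun (t b : ℝ) : ℝ := if b = 0 then 0 else Real.exp (-t * (b⁻¹ - 1))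

theorem continuousOn_heatFun {t : ℝ} (ht : 0 < t) : ContinuousOn (heatFun t) (Set.Icc 0 1) := by
  intro b hb
  rcases eq_or_lt_of_le hb.1 with h | h
  · subst h
    have h1 : Tendsto (fun b : ℝ => Real.exp (-t * (b⁻¹ - 1))) (𝓝[>] 0) (𝓝 0) := by
      refine Real.tendsto_exp_atBot.comp ?_
      refine Tendsto.const_mul_atTop_of_neg (by linarith) ?_
      exact tendsto_atTop_add_const_right _ _ tendsto_inv_nhdsGT_zero
    have h2 : ContinuousWithinAt (heatFun t) (Set.Ioi 0) 0 := by
      have h0 : heatFun t 0 = 0 := by simp [heatFun]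
      rw [ContinuousWithinAt, h0]
      refine h1.congr' ?_
      filter_upwards [self_mem_nhdsWithin] with b hb
      simp [heatFun, (ne_of_gt hb : b ≠ 0)]
    exact (continuousWithinAt_Ioi_iff_Ici.1 h2).mono Set.Icc_subset_Ici_self
  · have h1 : ContinuousAt (fun b : ℝ => Real.exp (-t * (b⁻¹ - 1))) b := by
      have : ContinuousAt (fun b : ℝ => b⁻¹) b := continuousAt_inv₀ h.ne'
      fun_prop
    refine (h1.congr ?_).continuousWithinAt
    filter_upwards [lt_mem_nhds h] with c hc
    simp [heatFun, (ne_of_gt hc : c ≠ 0)]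

/-- The operator `exp (-t A)`, `t ≥ 0`, of the functional calculus of a positive self-adjoint
(unbounded) operator `A`. For `t > 0` it is `f ((1 + A)⁻¹)`, where `f (1 / (1 + a)) = exp (-t a)` for
all `a ≥ 0` and `f 0 = 0`; the operator `(1 + A)⁻¹` is bounded and self-adjoint with spectrum
in `[0, 1]`, where `f` is continuous. -/
def expNeg [CompleteSpace X] (t : ℝ) (A : X →ₗ.[ℂ] X) : X →L[ℂ] X :=
  if t = 0 then 1 else cfc (heatFun t) (resolvent A (-1))

end Operators

section Fibers

variable {d : ℕ} {𝓗 𝔥 : Type*}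
  [NormedAddCommGroup 𝓗] [InnerProductSpace ℂ 𝓗]
  [NormedAddCommGroup 𝔥] [InnerProductSpace ℂ 𝔥]

/-- The graph of `Π* (∫^⊕ H(P) dP) Π`, where `V` is the unitary `Π` and `Φ_P = (Π Φ)(P)`: the pairs `(Φ, Φ')` with `Φ_P` in the domain of `H(P)` and
`Φ'_P = H(P) Φ_P` for almost every `P`. -/
def fiberGraph (V : 𝓗 ≃ₗᵢ[ℂ] Lp 𝔥 2 (volume : Measure (Momentum d)))
    (H : Momentum d → 𝔥 →ₗ.[ℂ] 𝔥) : Submodule ℂ (𝓗 × 𝓗) where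
  carrier := {x | ∀ᵐ P, (V x.1 P, V x.2 P) ∈ (H P).graph}
  zero_mem' := by
    have h0 : (V (0 : 𝓗) : Momentum d → 𝔥) =ᵐ[volume] 0 := by
      rw [map_zero]
      exact Lp.coeFn_zero _ _ _
    filter_upwards [h0] with P h
    simp only [Prod.fst_zero, Prod.snd_zero, h, Pi.zero_apply]
    exact (H P).graph.zero_mem
  add_mem' := by
    intro x y hx hy
    have h1 := Lp.coeFn_add (V x.1) (V y.1)
    have h2 := Lp.coeFn_add (V x.2) (V y.2)
    filter_upwards [hx, hy, h1, h2] with P hx hy h1 h2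
    simp only [Prod.fst_add, Prod.snd_add, map_add, h1, h2, Pi.add_apply]
    exact (H P).graph.add_mem hx hy
  smul_mem' := by
    intro c x hx
    have h1 := Lp.coeFn_smul c (V x.1)
    have h2 := Lp.coeFn_smul c (V x.2)
    filter_upwards [hx, h1, h2] with P hx h1 h2
    simp only [Prod.smul_fst, Prod.smul_snd, map_smul, h1, h2, Pi.smul_apply]
    exact (H P).graph.smul_mem c hx

/-- The operator `H = Π* (∫^⊕ H(P) dP) Π` with its maximal domain. -/
def fiberOperator (V : 𝓗 ≃ₗᵢ[ℂ] Lp 𝔥 2 (volume : Measure (Momentum d)))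
    (H : Momentum d → 𝔥 →ₗ.[ℂ] 𝔥) : 𝓗 →ₗ.[ℂ] 𝓗 :=
  (fiberGraph V H).toLinearPMap

theorem mem_graph_fiberOperator (V : 𝓗 ≃ₗᵢ[ℂ] Lp 𝔥 2 (volume : Measure (Momentum d)))
    (H : Momentum d → 𝔥 →ₗ.[ℂ] 𝔥) (x y : 𝓗) :
    (x, y) ∈ (fiberOperator V H).graph ↔ ∀ᵐ P, (V x P, V y P) ∈ (H P).graph := by
  have key : (fiberGraph V H).toLinearPMap.graph = fiberGraph V H := by
    refine Submodule.toLinearPMap_graph_eq _ ?_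
    rintro ⟨u, v⟩ (huv : ∀ᵐ P, (V u P, V v P) ∈ (H P).graph) (hu : u = 0)
    subst hu
    have h0 : (V (0 : 𝓗) : Momentum d → 𝔥) =ᵐ[volume] 0 := by
      rw [map_zero]
      exact Lp.coeFn_zero _ _ _
    have hv : V v = 0 := by
      refine Lp.ext ?_
      filter_upwards [huv, h0, Lp.coeFn_zero 𝔥 2 (volume : Measure (Momentum d))] with P h h0 h1
      rw [h1]
      exact (H P).graph_fst_eq_zero_snd h h0
    exact (map_eq_zero_iff V V.injective).1 hv
  rw [fiberOperator, key]
  rfl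

/-- The momentum shift `U(k)`, `(U(k) Φ)_P = Φ_{P + k}`. -/
def shift (V : 𝓗 ≃ₗᵢ[ℂ] Lp 𝔥 2 (volume : Measure (Momentum d))) (k : Momentum d) : 𝓗 →L[ℂ] 𝓗 :=
  (V.symm.toLinearIsometry.comp
    ((Lp.compMeasurePreservingₗᵢ ℂ (fun P : Momentum d => P + k)
      (measurePreserving_add_right volume k)).comp V.toLinearIsometry)).toContinuousLinearMap

/-- The set `{P : |P| ∈ Δ}`. -/
def shell (d : ℕ) (Δ : Set ℝ) : Set (Momentum d) := {P | ‖P‖ ∈ Δ}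

/-- The standing assumptions on the fiber family `H(P)`. The energy-momentum relation is
`E(P) = inf spec H(P) = Er |P|` (only `Er` on `[0, ∞)` matters), its global minima are the spheres
`|P| = Q ℓ`, `ℓ = 0, …, L`, the set `Δ ℓ` is a neighbourhood of `Q ℓ`, the number `n ℓ` is the order
of the minimum at `Q ℓ`, and `ψ P` is a normalized ground state of `H(P)`. -/
structure StandingAssumptions {L : ℕ} (H : Momentum d → 𝔥 →ₗ.[ℂ] 𝔥) (Er : ℝ → ℝ)
    (Q : Fin (L + 1) → ℝ) (Δ : Fin (L + 1) → Set ℝ) (n : Fin (L + 1) → ℕ)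
    (ψ : Momentum d → 𝔥) [CompleteSpace 𝔥] : Prop where
  selfAdjoint : ∀ P, IsSelfAdjoint (H P)
  positive : ∀ P, IsPositiveOp (H P)
  /-- Real analyticity of the family, in the sense of resolvents. -/
  analytic : ∀ (P₀ : Momentum d) (ξ : ℂ), ξ ∈ resolventSet (H P₀) →
    (∀ᶠ P in 𝓝 P₀, ξ ∈ resolventSet (H P)) ∧ AnalyticAt ℝ (fun P => resolvent (H P) ξ) P₀
  /-- Rotation invariance of the energy-momentum relation. -/
  radial : ∀ P, infSpec (H P) = Er ‖P‖
  Q_nonneg : 0 ≤ Q 0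
  Q_strictMono : StrictMono Q
  /-- The minimal value of `E` is `0` and it is attained exactly on the spheres `|P| = Q ℓ`. -/
  minima : ∀ P, infSpec (H P) = 0 ↔ ∃ ℓ, ‖P‖ = Q ℓ
  /-- The minimal value is not approached as `|P| → ∞`. -/
  pos_at_infinity : ∃ δ > 0, ∀ᶠ P in cocompact (Momentum d), δ ≤ infSpec (H P)
  Δ_mem_nhds : ∀ ℓ, Δ ℓ ∈ 𝓝 (Q ℓ)
  energy_analytic : ∀ ℓ, AnalyticOnNhd ℝ (fun P => infSpec (H P)) (shell d (Δ ℓ))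
  two_le_n : ∀ ℓ, 2 ≤ n ℓ
  /-- `Er (Q ℓ + R)` behaves like a nonzero multiple of `R ^ n ℓ` for small `R` (with `R ≥ 0` if
  `Q ℓ = 0`). -/
  order : ∀ ℓ, ∃ c : ℝ, c ≠ 0 ∧
    (fun R => Er (Q ℓ + R)) ~[𝓝[Set.Ici (-Q ℓ)] 0] (fun R => c * R ^ n ℓ)
  /-- `E(P)` is a simple eigenvalue with normalized eigenvector `ψ P`. -/
  ψ_norm : ∀ ℓ, ∀ P ∈ shell d (Δ ℓ), ‖ψ P‖ = 1
  ψ_simple : ∀ ℓ, ∀ P ∈ shell d (Δ ℓ), ∀ v : 𝔥,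
    (v, (infSpec (H P) : ℂ) • v) ∈ (H P).graph ↔ ∃ c : ℂ, v = c • ψ P
  /-- The projections `|ψ P⟩⟨ψ P|` depend strongly continuously on `P`. -/
  ψ_continuous : ∀ ℓ, ∀ v : 𝔥, ContinuousOn (fun P => ⟪ψ P, v⟫_ℂ • ψ P) (shell d (Δ ℓ))

/-- Admissible pinning vectors `φ`: near the minima, `P ↦ |⟨φ_P, ψ_P⟩|` agrees almost everywhere with
a continuous function which does not vanish on the spheres `|P| = Q ℓ`, and the norms `‖φ_P‖` are
essentially bounded there. -/
structure IsAdmissible {L : ℕ} (V : 𝓗 ≃ₗᵢ[ℂ] Lp 𝔥 2 (volume : Measure (Momentum d)))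
    (Q : Fin (L + 1) → ℝ) (Δ : Fin (L + 1) → Set ℝ) (ψ : Momentum d → 𝔥) (φ : 𝓗) : Prop where
  overlap : ∀ ℓ, ∃ g : Momentum d → ℝ, ContinuousOn g (shell d (Δ ℓ)) ∧
    (∀ P : Momentum d, ‖P‖ = Q ℓ → g P ≠ 0) ∧
    ∀ᵐ P : Momentum d, P ∈ shell d (Δ ℓ) → ‖⟪V φ P, ψ P⟫_ℂ‖ = g P
  bounded : ∀ ℓ, ∃ C : ℝ, ∀ᵐ P : Momentum d, P ∈ shell d (Δ ℓ) → ‖V φ P‖ ≤ C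

variable [CompleteSpace 𝓗]

/-- The unnormalized two-sided characteristic function
`⟨φ, exp (-T H) U(k) exp (-t H) U(k)* exp (-T H) φ⟩`. -/
def charFunTilde (V : 𝓗 ≃ₗᵢ[ℂ] Lp 𝔥 2 (volume : Measure (Momentum d)))
    (H : Momentum d → 𝔥 →ₗ.[ℂ] 𝔥) (φ : 𝓗) (T : ℝ) (k : Momentum d) (t : ℝ) : ℂ :=
  ⟪φ, expNeg T (fiberOperator V H) (shift V k (expNeg t (fiberOperator V H)
    (ContinuousLinearMap.adjoint (shift V k) (expNeg T (fiberOperator V H) φ))))⟫_ℂ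

/-- The normalized two-sided characteristic function `G_T(k, t)`. -/
def charFun (V : 𝓗 ≃ₗᵢ[ℂ] Lp 𝔥 2 (volume : Measure (Momentum d)))
    (H : Momentum d → 𝔥 →ₗ.[ℂ] 𝔥) (φ : 𝓗) (T : ℝ) (k : Momentum d) (t : ℝ) : ℂ :=
  charFunTilde V H φ T k t / charFunTilde V H φ T 0 t

/-- The central limit theorem for two-sided pinning by `φ` with diffusion constant `σ²`: the limit
`G_∞(k, t)` of `G_T(k, t)` as `T → ∞` exists, and `G_∞(ε k, ε⁻² t) → exp (-σ² k² t / 2)` as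
`ε → 0`. -/
def TwoSidedCLT (V : 𝓗 ≃ₗᵢ[ℂ] Lp 𝔥 2 (volume : Measure (Momentum d)))
    (H : Momentum d → 𝔥 →ₗ.[ℂ] 𝔥) (φ : 𝓗) (σ : ℝ) : Prop :=
  ∃ Ginf : Momentum d → ℝ → ℂ,
    (∀ (k : Momentum d) (t : ℝ), 0 ≤ t →
      Tendsto (fun T : ℝ => charFun V H φ T k t) atTop (𝓝 (Ginf k t))) ∧
    ∀ (k : Momentum d) (t : ℝ), 0 ≤ t →
      Tendsto (fun ε : ℝ => Ginf (ε • k) ((ε ^ 2)⁻¹ * t)) (𝓝[≠] 0)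
        (𝓝 ((Real.exp (-(1 / 2) * σ ^ 2 * ‖k‖ ^ 2 * t) : ℝ) : ℂ))


end Fibers

end FiberCLT

end

/-!
The operator `H(P)` enters only through the bounded operator `B P = (1 + H(P))⁻¹`, which is
self-adjoint, has spectrum in `[0, 1]`, and is norm continuous in `P`. Its norm is `1 / (1 + E(P))`
(`IsInvOneAdd.norm_eq`), so `E` is continuous. Approximating the heat function by polynomials shows
that `exp (-t H)` acts fiberwise as `exp (-t H(P))`, and hence (`charFunTilde_eq_integral`) that the
unnormalized characteristic function is the integral over `P` of
`F T k t P = ⟨u, exp (-t H(P + k)) u⟩` with `u = exp (-T H(P)) φ_P`.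

The ground state energy gives the upper bound `F T k t P ≤ exp (-t E(P + k)) ‖u‖²`. For `P` near a
minimum of `E` and small `k` there is a lower bound of the same form up to a constant factor
(`StandingAssumptions.density_lower`), since there `u` has a component along the ground state
`ψ (P + k)` of size comparable to `‖u‖`. This comparison replaces a spectral gap above `E(P)`, which
is not available: the part of `u` orthogonal to the ground state `ψ (P + k)` need not become small
as `T → ∞`, but its contribution to `F` is nonnegative.

As `T → ∞` the mass `‖u‖² dP` concentrates at the zeros of `E`. A zero `P₀` is heavy (`IsHeavy`) if
each of its neighbourhoods carries a fixed fraction of the mass for arbitrarily large `T`; some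
zero is, by compactness (`IsHeatDensity.exists_isHeavy`). The central limit theorem has two
consequences for a heavy zero.

* If `E(P + ε k) < κ ε²` at all zeros `P` close to `P₀`, then `σ² |k|² / 2 ≤ κ`
  (`IsHeatDensity.le_of_isHeavy`). Hence `σ² ≤ E_r''(Q_ℓ)` for `|P₀| = Q_ℓ`. If `d ≥ 2` and
  `Q_ℓ > 0`, one may take `k` orthogonal to `P₀` and `κ` arbitrarily small, a contradiction. So
  in dimension `d ≥ 2` only `P₀ = 0` can be heavy.
* The fraction of the mass near `P₀` forces a strict inequality if `E_r''(Q_ℓ) > σ²` and all second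
  derivatives are at least `σ²` (`IsHeatDensity.exp_le_of_isHeavy`).

It remains to compare the mass near different zeros. If `P₀` is heavy and `P₀ = 0` or `d = 1`,
then `E(P) ≥ c |P - P₀|²` near `P₀`, so the total mass is at most `C T ^ (-d / 2)` for arbitrarily
large `T`. Every zero contributes at least `c T ^ (-d / 2)`. For `d = 1` it follows that all zeros
are heavy; for `d ≥ 2` a sphere of zeros of positive radius, which has infinitely many points, would
contribute more than any multiple of `T ^ (-d / 2)`, so there is none.
-/

noncomputable section

namespace FiberCLT

/-! ### Resolvents of positive self-adjoint operators -/

section Resolvent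

variable {X : Type*} [NormedAddCommGroup X] [InnerProductSpace ℂ X]

theorem isResolvent_iff_graph {A : X →ₗ.[ℂ] X} {ξ : ℂ} {R : X →L[ℂ] X} :
    IsResolvent A ξ R ↔ (∀ y, (R y, y + ξ • R y) ∈ A.graph) ∧
      ∀ x y, (x, y) ∈ A.graph → R (y - ξ • x) = x := by
  constructor
  · intro h
    refine ⟨fun y => ?_, fun x y hxy => ?_⟩
    · obtain ⟨hy, e⟩ := h.right_inv y
      rw [LinearPMap.mem_graph_iff]
      exact ⟨⟨R y, hy⟩, rfl, sub_eq_iff_eq_add.1 e⟩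
    · obtain ⟨z, hz1, hz2⟩ := (LinearPMap.mem_graph_iff A).1 hxy
      dsimp only at hz1 hz2
      rw [← hz1, ← hz2]
      exact h.left_inv z
  · rintro ⟨h1, h2⟩
    refine ⟨fun y => ?_, fun x => h2 _ _ (A.mem_graph x)⟩
    obtain ⟨z, hz1, hz2⟩ := (LinearPMap.mem_graph_iff A).1 (h1 y)
    dsimp only at hz1 hz2
    refine ⟨hz1 ▸ z.2, ?_⟩
    have : (⟨R y, hz1 ▸ z.2⟩ : A.domain) = z := Subtype.ext hz1.symm
    rw [this, hz2]
    simp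

theorem IsPositiveOp.re_inner_graph {A : X →ₗ.[ℂ] X} (hA : IsPositiveOp A) {x y : X}
    (h : (x, y) ∈ A.graph) : 0 ≤ (⟪x, y⟫_ℂ).re := by
  obtain ⟨z, hz1, hz2⟩ := (LinearPMap.mem_graph_iff A).1 h
  dsimp only at hz1 hz2
  rw [← hz1, ← hz2]
  exact hA z

theorem IsPositiveOp.norm_le_graph {A : X →ₗ.[ℂ] X} (hA : IsPositiveOp A) {x y : X}
    (h : (x, y) ∈ A.graph) : ‖x‖ ≤ ‖x + y‖ ∧ ‖y‖ ≤ ‖x + y‖ := by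
  have h1 := hA.re_inner_graph h
  have h2 := norm_add_sq (𝕜 := ℂ) x y
  change ‖x + y‖ ^ 2 = ‖x‖ ^ 2 + 2 * (⟪x, y⟫_ℂ).re + ‖y‖ ^ 2 at h2
  constructor <;> refine le_of_sq_le_sq ?_ (norm_nonneg _) <;>
    nlinarith [sq_nonneg ‖x‖, sq_nonneg ‖y‖]

variable [CompleteSpace X]

theorem inner_graph_comm {A : X →ₗ.[ℂ] X} (hA : IsSelfAdjoint A) {x y x' y' : X}
    (h : (x, y) ∈ A.graph) (h' : (x', y') ∈ A.graph) : ⟪y, x'⟫_ℂ = ⟪x, y'⟫_ℂ := by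
  obtain ⟨z, rfl, rfl⟩ := (LinearPMap.mem_graph_iff A).1 h
  obtain ⟨z', rfl, rfl⟩ := (LinearPMap.mem_graph_iff A).1 h'
  have := LinearPMap.adjoint_isFormalAdjoint hA.dense_domain
  rw [LinearPMap.isSelfAdjoint_def.1 hA] at this
  exact this z z'

theorem mem_graph_of_inner {A : X →ₗ.[ℂ] X} (hA : IsSelfAdjoint A) {z w : X}
    (h : ∀ x y, (x, y) ∈ A.graph → ⟪w, x⟫_ℂ = ⟪z, y⟫_ℂ) : (z, w) ∈ A.graph := by
  have hd := hA.dense_domain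
  have h' : ∀ x : A.domain, ⟪w, x⟫_ℂ = ⟪z, A x⟫_ℂ := fun x => h _ _ (A.mem_graph x)
  have hz := LinearPMap.mem_adjoint_domain_of_exists (T := A) z ⟨w, h'⟩
  have hw := LinearPMap.adjoint_apply_eq hd ⟨z, hz⟩ h'
  have : (z, w) ∈ A.adjoint.graph := (LinearPMap.mem_graph_iff _).2 ⟨⟨z, hz⟩, rfl, hw⟩
  rwa [LinearPMap.isSelfAdjoint_def.1 hA] at this

/-- The map `1 + A` is bounded below, so its range is closed, and a vector orthogonal to the range
is an eigenvector of `A` with eigenvalue `-1`, hence zero. -/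
theorem neg_one_mem_resolventSet {A : X →ₗ.[ℂ] X} (hA : IsSelfAdjoint A) (hp : IsPositiveOp A) :
    (-1 : ℂ) ∈ resolventSet A := by
  let f : A.graph →L[ℂ] X :=
    (ContinuousLinearMap.fst ℂ X X + ContinuousLinearMap.snd ℂ X X).comp A.graph.subtypeL
  have hf : ∀ g : A.graph, f g = g.1.1 + g.1.2 := fun g => rfl
  have hfb : ∀ g : A.graph, ‖g‖ ≤ ‖f g‖ := fun g => by
    have := hp.norm_le_graph (x := g.1.1) (y := g.1.2) g.2
    rw [hf]
    exact max_le this.1 this.2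
  have hanti : AntilipschitzWith 1 f :=
    AddMonoidHomClass.antilipschitz_of_bound f (by simpa using hfb)
  have hcl : IsClosed (A.graph : Set (X × X)) := hA.isClosed
  have : CompleteSpace A.graph := hcl.completeSpace_coe
  have hrange : IsClosed (f.range : Set X) := by
    rw [LinearMap.coe_range]
    exact hanti.isClosed_range f.uniformContinuous
  have : CompleteSpace f.range := hrange.completeSpace_coe
  have htop : f.range = ⊤ := by
    rw [← Submodule.orthogonal_eq_bot_iff, Submodule.eq_bot_iff]
    intro z hz
    have hz' : ∀ x y, (x, y) ∈ A.graph → ⟪-z, x⟫_ℂ = ⟪z, y⟫_ℂ := by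
      intro x y hxy
      have := (Submodule.mem_orthogonal' _ _).1 hz (f ⟨(x, y), hxy⟩) ⟨_, rfl⟩
      rw [hf, inner_add_right] at this
      rw [inner_neg_left]
      linear_combination -this
    have hg := mem_graph_of_inner hA hz'
    have h0 := hp.re_inner_graph hg
    rw [inner_neg_right, inner_self_eq_norm_sq_to_K] at h0
    have h1 : ‖z‖ ^ 2 ≤ 0 := by
      have : (-((‖z‖ : ℂ) ^ 2)).re = -‖z‖ ^ 2 := by norm_cast
      have h2 : 0 ≤ (-((‖z‖ : ℂ) ^ 2)).re := h0
      linarith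
    have : ‖z‖ = 0 := by nlinarith [norm_nonneg z]
    simpa using this
  have hsurj : Function.Surjective f := LinearMap.range_eq_top.1 htop
  let e := LinearEquiv.ofBijective f.toLinearMap ⟨hanti.injective, hsurj⟩
  have he : ∀ g, e g = g.1.1 + g.1.2 := fun g => rfl
  let R0 : X →ₗ[ℂ] X := (LinearMap.fst ℂ X X ∘ₗ A.graph.subtype) ∘ₗ e.symm.toLinearMap
  have hR0 : ∀ y, R0 y = (e.symm y).1.1 := fun y => rfl
  let R : X →L[ℂ] X := R0.mkContinuous 1 (fun y => by
    have := hp.norm_le_graph (x := (e.symm y).1.1) (y := (e.symm y).1.2) (e.symm y).2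
    rw [← he, e.apply_symm_apply] at this
    rw [hR0, one_mul]
    exact this.1)
  refine ⟨R, isResolvent_iff_graph.2 ⟨fun y => ?_, fun x y hxy => ?_⟩⟩
  · have h1 := he (e.symm y)
    rw [e.apply_symm_apply] at h1
    have h2 : (R y, y + (-1 : ℂ) • R y) = (e.symm y).1 := by
      refine Prod.ext rfl ?_
      change y + (-1 : ℂ) • (e.symm y).1.1 = _
      nth_rewrite 1 [h1]
      simp
    rw [h2]
    exact (e.symm y).2
  · have h1 : y - (-1 : ℂ) • x = e ⟨(x, y), hxy⟩ := by
      rw [he]; simp [add_comm]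
    change (e.symm (y - (-1 : ℂ) • x)).1.1 = x
    rw [h1, e.symm_apply_apply]

/-- `B` is the operator `(1 + A)⁻¹` of a positive self-adjoint operator `A`. -/
structure IsInvOneAdd (A : X →ₗ.[ℂ] X) (B : X →L[ℂ] X) : Prop where
  selfAdjoint : IsSelfAdjoint A
  positive : IsPositiveOp A
  isResolvent : IsResolvent A (-1) B

theorem isInvOneAdd_resolvent {A : X →ₗ.[ℂ] X} (hA : IsSelfAdjoint A) (hp : IsPositiveOp A) :
    IsInvOneAdd A (resolvent A (-1)) :=
  ⟨hA, hp, isResolvent_resolvent (neg_one_mem_resolventSet hA hp)⟩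

namespace IsInvOneAdd

variable {A : X →ₗ.[ℂ] X} {B : X →L[ℂ] X}

theorem mem_graph (h : IsInvOneAdd A B) (y : X) : (B y, y - B y) ∈ A.graph := by
  have := (isResolvent_iff_graph.1 h.isResolvent).1 y
  simpa [sub_eq_add_neg] using this

theorem apply_add (h : IsInvOneAdd A B) {x y : X} (hxy : (x, y) ∈ A.graph) : B (x + y) = x := by
  have := (isResolvent_iff_graph.1 h.isResolvent).2 x y hxy
  simpa [add_comm] using this

theorem isPositive (h : IsInvOneAdd A B) : B.IsPositive := by
  rw [ContinuousLinearMap.isPositive_def']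
  refine ⟨ContinuousLinearMap.isSelfAdjoint_iff_isSymmetric.2 fun x y => ?_, fun x => ?_⟩
  · have := inner_graph_comm h.selfAdjoint (h.mem_graph x) (h.mem_graph y)
    rw [inner_sub_left, inner_sub_right] at this
    change ⟪B x, y⟫_ℂ = ⟪x, B y⟫_ℂ
    linear_combination -this
  · have h1 := h.positive.re_inner_graph (h.mem_graph x)
    rw [inner_sub_right, Complex.sub_re] at h1
    have h2 : 0 ≤ (⟪B x, B x⟫_ℂ).re := inner_self_nonneg (𝕜 := ℂ)
    change 0 ≤ (⟪B x, x⟫_ℂ).re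
    linarith

theorem isSelfAdjoint (h : IsInvOneAdd A B) : IsSelfAdjoint B := h.isPositive.isSelfAdjoint

theorem norm_le_one (h : IsInvOneAdd A B) : ‖B‖ ≤ 1 := by
  refine ContinuousLinearMap.opNorm_le_bound _ zero_le_one fun y => ?_
  have := (h.positive.norm_le_graph (h.mem_graph y)).1
  simpa using this

end IsInvOneAdd

theorem spectrum_subset_Icc_norm {B : X →L[ℂ] X} (h : B.IsPositive) :
    spectrum ℝ B ⊆ Set.Icc 0 ‖B‖ := by
  intro b hb
  refine ⟨spectrum_nonneg_of_nonneg ((ContinuousLinearMap.nonneg_iff_isPositive B).2 h) hb, ?_⟩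
  have hX : Nontrivial X := by
    by_contra hX
    rw [not_nontrivial_iff_subsingleton] at hX
    simp [spectrum.of_subsingleton] at hb
  exact (le_abs_self b).trans (spectrum.norm_le_norm_of_mem hb)

/-- The spectral mapping between `A` and `(1 + A)⁻¹`: with `z = 1 + x`, the operators
`((1 + A)⁻¹ - 1 / z)⁻¹` and `(A - x)⁻¹` are related by
`((1 + A)⁻¹ - 1 / z)⁻¹ = -z - z² (A - x)⁻¹`. -/
theorem IsInvOneAdd.mem_spec_iff {A : X →ₗ.[ℂ] X} {B : X →L[ℂ] X} (h : IsInvOneAdd A B) {x : ℝ}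
    (hx : 1 + x ≠ 0) : (x : ℂ) ∈ spec A ↔ (1 + x)⁻¹ ∈ spectrum ℝ B := by
  have hz : (1 + x : ℂ) ≠ 0 := by exact_mod_cast hx
  set z : ℂ := 1 + x with hzdef
  have hxz : (x : ℂ) = z - 1 := by rw [hzdef]; ring
  have halg : algebraMap ℝ (X →L[ℂ] X) (1 + x)⁻¹ = z⁻¹ • (1 : X →L[ℂ] X) := by
    ext v
    simp [Algebra.algebraMap_eq_smul_one, hzdef]
    rw [← Complex.coe_smul]
    simp
  rw [spec, Set.mem_compl_iff, spectrum.mem_iff, not_iff_not, halg]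
  have hBR := (isResolvent_iff_graph.1 h.isResolvent)
  constructor
  · rintro ⟨R, hR⟩
    have hR' := isResolvent_iff_graph.1 hR
    have e1 : ∀ y, R y = B y + z • B (R y) := fun y => by
      have h1 := hBR.2 _ _ (hR'.1 y)
      have : y + (x : ℂ) • R y - (-1 : ℂ) • R y = y + z • R y := by
        rw [hxz]; module
      rw [this, map_add, map_smul] at h1
      exact h1.symm
    have e2 : ∀ y, B y = R y - z • R (B y) := fun y => by
      have h1 := hR'.2 _ _ (hBR.1 y)
      have : y + (-1 : ℂ) • B y - (x : ℂ) • B y = y - z • B y := by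
        rw [hxz]; module
      rw [this, map_sub, map_smul] at h1
      exact h1.symm
    have e3 : ∀ y, z • B (R y) = R y - B y := fun y => by
      rw [eq_sub_iff_add_eq, add_comm]; exact (e1 y).symm
    have e4 : ∀ y, z • R (B y) = R y - B y := fun y => by
      rw [eq_sub_iff_add_eq, add_comm]; exact eq_sub_iff_add_eq.1 (e2 y)
    refine ⟨⟨z⁻¹ • 1 - B, z • 1 + z ^ 2 • R, ?_, ?_⟩, rfl⟩
    · ext y
      change z⁻¹ • (z • y + z ^ 2 • R y) - B (z • y + z ^ 2 • R y) = y
      rw [map_add, map_smul, map_smul, pow_two, mul_smul, mul_smul, e3]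
      simp only [smul_add, smul_smul, inv_mul_cancel₀ hz, ← mul_assoc, smul_sub, one_smul, one_mul]
      abel
    · ext y
      change z • (z⁻¹ • y - B y) + z ^ 2 • R (z⁻¹ • y - B y) = y
      rw [map_sub, map_smul, pow_two, mul_smul, smul_sub z (z⁻¹ • R y), e4]
      simp only [smul_sub, smul_smul, mul_inv_cancel₀ hz, one_smul]
      abel
  · rintro ⟨⟨D, C, hDC, hCD⟩, hD⟩
    change D = _ at hD
    subst hD
    have e1 : ∀ y, z⁻¹ • C y = y + B (C y) := fun y => by
      have : z⁻¹ • C y - B (C y) = y := congrArg (fun T : X →L[ℂ] X => T y) hDC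
      exact sub_eq_iff_eq_add.1 this
    have e2 : ∀ y, C (z⁻¹ • y - B y) = y := fun y =>
      congrArg (fun T : X →L[ℂ] X => T y) hCD
    refine ⟨z⁻¹ • (B * C), isResolvent_iff_graph.2 ⟨fun y => ?_, fun a b hab => ?_⟩⟩
    · have h1 := hBR.1 (z⁻¹ • C y)
      have h2 : (z⁻¹ • (B * C)) y = B (z⁻¹ • C y) := by rw [map_smul]; rfl
      have h3 : z⁻¹ • C y = y + z • B (z⁻¹ • C y) := by
        rw [map_smul, smul_smul, mul_inv_cancel₀ hz, one_smul, ← e1]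
      rw [h2]
      convert h1 using 2
      nth_rewrite 2 [h3]
      rw [hxz]
      module
    · have h1 := h.apply_add hab
      have h2 : b - (x : ℂ) • a = z • (z⁻¹ • (a + b) - B (a + b)) := by
        rw [h1, smul_sub, smul_smul, mul_inv_cancel₀ hz, hxz]
        module
      change z⁻¹ • B (C (b - (x : ℂ) • a)) = a
      rw [h2, map_smul, map_smul, e2, h1, smul_smul, inv_mul_cancel₀ hz, one_smul]

namespace IsInvOneAdd

variable {A : X →ₗ.[ℂ] X} {B : X →L[ℂ] X}

theorem nonneg_of_mem_spec (h : IsInvOneAdd A B) {x : ℝ} (hx : (x : ℂ) ∈ spec A) : 0 ≤ x := by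
  have h1 : 1 + x ≠ 0 := by
    intro h0
    have : x = -1 := by linarith
    subst this
    refine hx ⟨B, ?_⟩
    convert h.isResolvent using 1
    norm_num
  have h2 := spectrum_subset_Icc_norm h.isPositive ((h.mem_spec_iff h1).1 hx)
  have h3 : 0 < 1 + x := inv_pos.1 (lt_of_le_of_ne h2.1 (inv_ne_zero h1).symm)
  have h4 := (inv_le_one₀ h3).1 (h2.2.trans h.norm_le_one)
  linarith

theorem infSpec_nonneg (h : IsInvOneAdd A B) : 0 ≤ infSpec A :=
  Real.sInf_nonneg fun _ hx => h.nonneg_of_mem_spec hx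

theorem infSpec_le (h : IsInvOneAdd A B) {x : ℝ} (hx : (x : ℂ) ∈ spec A) : infSpec A ≤ x :=
  csInf_le ⟨0, fun _ hx => h.nonneg_of_mem_spec hx⟩ hx

theorem norm_pos [Nontrivial X] (h : IsInvOneAdd A B) : 0 < ‖B‖ := by
  rw [norm_pos_iff]
  rintro rfl
  have h2 : ∀ y : X, y = 0 := fun y => by
    have h1 := h.mem_graph y
    exact A.graph_fst_eq_zero_snd (by simpa using h1) rfl
  obtain ⟨y, hy⟩ := exists_ne (0 : X)
  exact hy (h2 y)

/-- The bottom of the spectrum of `A` in terms of the norm of `(1 + A)⁻¹`. -/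
theorem infSpec_eq [Nontrivial X] (h : IsInvOneAdd A B) : infSpec A = ‖B‖⁻¹ - 1 := by
  have hpos := h.norm_pos
  have hmem : ‖B‖ ∈ spectrum ℝ B := by
    have h0 : IsSelfAdjoint B := h.isSelfAdjoint
    obtain ⟨b, hb, hb'⟩ := (IsGreatest.norm_cfc (𝕜 := ℝ) id B continuousOn_id h0).1
    rw [cfc_id ℝ B h0] at hb'
    dsimp only [id] at hb'
    rw [Real.norm_of_nonneg (spectrum_subset_Icc_norm h.isPositive hb).1] at hb'
    rwa [← hb']
  have h1 : ((‖B‖⁻¹ - 1 : ℝ) : ℂ) ∈ spec A := by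
    rw [h.mem_spec_iff (by simpa using hpos.ne')]
    simpa using hmem
  refine le_antisymm (h.infSpec_le h1) (le_csInf ⟨_, h1⟩ fun x hx => ?_)
  have hx0 := h.nonneg_of_mem_spec hx
  have h2 := (spectrum_subset_Icc_norm h.isPositive ((h.mem_spec_iff (by linarith)).1 hx)).2
  have := inv_anti₀ (by positivity) h2
  rw [inv_inv] at this
  linarith

theorem norm_eq [Nontrivial X] (h : IsInvOneAdd A B) : ‖B‖ = (1 + infSpec A)⁻¹ := by
  rw [h.infSpec_eq]; simp

theorem apply_eigenvector (h : IsInvOneAdd A B) {x : ℝ} (hx : 0 ≤ x) {v : X}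
    (hv : (v, (x : ℂ) • v) ∈ A.graph) : B v = (1 + x)⁻¹ • v := by
  have h1 := h.apply_add hv
  have h2 : v + (x : ℂ) • v = (1 + x) • v := by
    rw [add_smul, one_smul, Complex.coe_smul]
  have h3 : B ((1 + x) • v) = (1 + x) • B v := B.map_smul_of_tower _ _
  rw [h2, h3] at h1
  rw [eq_inv_smul_iff₀ (by positivity), h1]

end IsInvOneAdd

end Resolvent

/-! ### The heat semigroup -/

theorem heatFun_nonneg (t b : ℝ) : 0 ≤ heatFun t b := by
  unfold heatFun; split_ifs <;> positivity

theorem heatFun_mul (s t b : ℝ) : heatFun s b * heatFun t b = heatFun (s + t) b := by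
  unfold heatFun
  split_ifs
  · simp
  · rw [← Real.exp_add]; ring_nf

theorem heatFun_inv_one_add (t : ℝ) {x : ℝ} (hx : 0 ≤ x) :
    heatFun t (1 + x)⁻¹ = Real.exp (-t * x) := by
  have : (1 + x)⁻¹ ≠ 0 := by positivity
  rw [heatFun, if_neg this, inv_inv, add_sub_cancel_left]

theorem exists_heatFun_eq {b : ℝ} (h0 : 0 < b) (h1 : b ≤ 1) :
    ∃ x : ℝ, 0 ≤ x ∧ b = (1 + x)⁻¹ :=
  ⟨b⁻¹ - 1, by linarith [(one_le_inv₀ h0).2 h1], by simp⟩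

theorem heatFun_le {t b x : ℝ} (ht : 0 ≤ t) (hx : 0 ≤ x) (hb : 0 ≤ b) (hbx : b ≤ (1 + x)⁻¹) :
    heatFun t b ≤ Real.exp (-t * x) := by
  rcases hb.eq_or_lt with rfl | hb
  · simp [heatFun, Real.exp_nonneg]
  · obtain ⟨y, hy, rfl⟩ := exists_heatFun_eq hb (hbx.trans (inv_le_one_of_one_le₀ (by linarith)))
    rw [heatFun_inv_one_add t hy]
    have : x ≤ y := by
      have := (inv_le_inv₀ (by positivity) (by positivity)).1 hbx
      linarith
    exact Real.exp_le_exp.2 (by nlinarith)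

/-- In terms of `a`, with `b = 1 / (1 + a)`, this is the inequality
`exp (-s a) (1 - exp (-t a)) ≤ t η exp (-s a) + exp (-s η)`: use `1 - exp (-t a) ≤ t a` for
`a ≤ η` and `exp (-s a) ≤ exp (-s η)` for `η ≤ a`. -/
theorem heatFun_add_ge {s t η b : ℝ} (hs : 0 ≤ s) (ht : 0 ≤ t) (hη : 0 ≤ η)
    (hb : b ∈ Set.Icc (0 : ℝ) 1) :
    (1 - t * η) * heatFun s b - Real.exp (-s * η) ≤ heatFun (s + t) b := by
  rcases hb.1.eq_or_lt with rfl | hb0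
  · simp [heatFun, Real.exp_nonneg]
  · obtain ⟨a, ha, rfl⟩ := exists_heatFun_eq hb0 hb.2
    rw [← heatFun_mul, heatFun_inv_one_add _ ha, heatFun_inv_one_add _ ha]
    have e0 := Real.exp_pos (-s * a)
    have e1 := Real.exp_pos (-s * η)
    have e2 := Real.exp_pos (-t * a)
    have e3 := Real.add_one_le_exp (-t * a)
    rcases le_total a η with h | h
    · have : 1 - t * η ≤ Real.exp (-t * a) := by nlinarith
      nlinarith
    · have : Real.exp (-s * a) ≤ Real.exp (-s * η) := Real.exp_le_exp.2 (by nlinarith)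
      have h3 : 0 ≤ t * η := mul_nonneg ht hη
      nlinarith [mul_pos e0 e2, mul_nonneg h3 e0.le]

theorem exists_polynomial_seq_near {f : ℝ → ℝ} (hf : ContinuousOn f (Set.Icc 0 1)) :
    ∃ p : ℕ → Polynomial ℝ, ∀ n, ∀ b ∈ Set.Icc (0 : ℝ) 1, |(p n).eval b - f b| ≤ 1 / (n + 1) := by
  have := fun n : ℕ => exists_polynomial_near_of_continuousOn 0 1 f hf (1 / ((n : ℝ) + 1))
    Nat.one_div_pos_of_nat
  choose p hp using this
  exact ⟨p, fun n b hb => (hp n b hb).le⟩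

section Op

variable {X : Type*} [NormedAddCommGroup X] [InnerProductSpace ℂ X] [CompleteSpace X]

/-- A bounded operator `B` with `0 ≤ B ≤ 1`. -/
structure IsPosContraction (B : X →L[ℂ] X) : Prop where
  isPositive : B.IsPositive
  norm_le_one : ‖B‖ ≤ 1

theorem IsInvOneAdd.isPosContraction {A : X →ₗ.[ℂ] X} {B : X →L[ℂ] X} (h : IsInvOneAdd A B) :
    IsPosContraction B := ⟨h.isPositive, h.norm_le_one⟩

/-- The operator `exp (-t A)` written as a function of `B = (1 + A)⁻¹`. -/
def heatOp (t : ℝ) (B : X →L[ℂ] X) : X →L[ℂ] X := if t = 0 then 1 else cfc (heatFun t) B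

theorem expNeg_eq_heatOp (t : ℝ) {A : X →ₗ.[ℂ] X} {B : X →L[ℂ] X} (h : IsResolvent A (-1) B) :
    expNeg t A = heatOp t B := by
  have : resolvent A (-1) = B := (isResolvent_resolvent ⟨B, h⟩).unique h
  rw [expNeg, heatOp, this]

theorem heatOp_zero (B : X →L[ℂ] X) : heatOp 0 B = 1 := if_pos rfl

theorem heatOp_of_pos {t : ℝ} (ht : 0 < t) (B : X →L[ℂ] X) : heatOp t B = cfc (heatFun t) B :=
  if_neg ht.ne'

theorem isPositive_heatOp (t : ℝ) (B : X →L[ℂ] X) : (heatOp t B).IsPositive := by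
  rw [heatOp]
  split_ifs
  · exact ContinuousLinearMap.isPositive_one
  · rw [← ContinuousLinearMap.nonneg_iff_isPositive]
    exact cfc_nonneg fun b _ => heatFun_nonneg t b

theorem inner_heatOp (t : ℝ) (B : X →L[ℂ] X) (u v : X) :
    ⟪u, heatOp t B v⟫_ℂ = ⟪heatOp t B u, v⟫_ℂ :=
  ((isPositive_heatOp t B).isSymmetric u v).symm

theorem re_inner_heatOp_nonneg (t : ℝ) (B : X →L[ℂ] X) (u : X) :
    0 ≤ (⟪u, heatOp t B u⟫_ℂ).re :=
  (isPositive_heatOp t B).re_inner_nonneg_right u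

namespace IsPosContraction

variable {B : X →L[ℂ] X}

theorem isSelfAdjoint (hB : IsPosContraction B) : IsSelfAdjoint B := hB.isPositive.isSelfAdjoint

theorem spectrum_subset (hB : IsPosContraction B) : spectrum ℝ B ⊆ Set.Icc 0 1 :=
  (spectrum_subset_Icc_norm hB.isPositive).trans (Set.Icc_subset_Icc_right hB.norm_le_one)

theorem continuousOn_heatFun_spectrum (hB : IsPosContraction B) {t : ℝ} (ht : 0 < t) :
    ContinuousOn (heatFun t) (spectrum ℝ B) :=
  (continuousOn_heatFun ht).mono hB.spectrum_subset

theorem tendsto_aeval (hB : IsPosContraction B) {f : ℝ → ℝ} (hf : ContinuousOn f (Set.Icc 0 1))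
    {p : ℕ → Polynomial ℝ}
    (hp : ∀ n, ∀ b ∈ Set.Icc (0 : ℝ) 1, |(p n).eval b - f b| ≤ 1 / (n + 1)) :
    Tendsto (fun n => Polynomial.aeval B (p n)) atTop (𝓝 (cfc f B)) := by
  have hsa := hB.isSelfAdjoint
  rw [tendsto_iff_norm_sub_tendsto_zero]
  refine squeeze_zero (fun _ => norm_nonneg _) (fun n => ?_) tendsto_one_div_add_atTop_nhds_zero_nat
  rw [← cfc_polynomial (p n) B hsa, ← cfc_sub _ _ B (p n).continuousOn (hf.mono hB.spectrum_subset)]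
  refine norm_cfc_le (by positivity) fun b hb => ?_
  exact hp n b (hB.spectrum_subset hb)

theorem heatOp_mul (hB : IsPosContraction B) {s t : ℝ} (hs : 0 ≤ s) (ht : 0 ≤ t) :
    heatOp s B * heatOp t B = heatOp (s + t) B := by
  rcases hs.eq_or_lt with rfl | hs
  · rw [heatOp_zero, one_mul, zero_add]
  rcases ht.eq_or_lt with rfl | ht
  · rw [heatOp_zero, mul_one, add_zero]
  rw [heatOp_of_pos hs, heatOp_of_pos ht, heatOp_of_pos (add_pos hs ht),
    ← cfc_mul _ _ B (hB.continuousOn_heatFun_spectrum hs) (hB.continuousOn_heatFun_spectrum ht)]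
  exact congrArg (fun f => cfc f B) (funext fun b => heatFun_mul s t b)

theorem norm_heatOp_le (hB : IsPosContraction B) {t x : ℝ} (ht : 0 ≤ t) (hx : 0 ≤ x)
    (hBx : ‖B‖ ≤ (1 + x)⁻¹) : ‖heatOp t B‖ ≤ Real.exp (-t * x) := by
  rcases ht.eq_or_lt with rfl | ht
  · have : ‖(1 : X →L[ℂ] X)‖ ≤ 1 := ContinuousLinearMap.norm_id_le
    simpa [heatOp_zero] using this
  rw [heatOp_of_pos ht]
  refine norm_cfc_le (Real.exp_nonneg _) fun b hb => ?_
  have hb' := spectrum_subset_Icc_norm hB.isPositive hb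
  rw [Real.norm_of_nonneg (heatFun_nonneg _ _)]
  exact heatFun_le ht.le hx hb'.1 (hb'.2.trans hBx)

theorem re_inner_heatOp_le (hB : IsPosContraction B) {t x : ℝ} (ht : 0 ≤ t) (hx : 0 ≤ x)
    (hBx : ‖B‖ ≤ (1 + x)⁻¹) (u : X) :
    (⟪u, heatOp t B u⟫_ℂ).re ≤ Real.exp (-t * x) * ‖u‖ ^ 2 := by
  have h1 := (Complex.re_le_norm _).trans (norm_inner_le_norm u (heatOp t B u))
  have h2 := (heatOp t B).le_of_opNorm_le (hB.norm_heatOp_le ht hx hBx) u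
  nlinarith [norm_nonneg u]

theorem heatOp_eigenvector (hB : IsPosContraction B) {x : ℝ} (hx : 0 ≤ x) {v : X}
    (hv : B v = (1 + x)⁻¹ • v) {t : ℝ} (ht : 0 ≤ t) :
    heatOp t B v = Real.exp (-t * x) • v := by
  rcases ht.eq_or_lt with rfl | ht
  · simp [heatOp_zero]
  rw [heatOp_of_pos ht]
  obtain ⟨p, hp⟩ := exists_polynomial_seq_near (continuousOn_heatFun ht)
  have h1 := (ContinuousLinearMap.apply ℂ X v).continuous.tendsto _ |>.comp
    (hB.tendsto_aeval (continuousOn_heatFun ht) hp)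
  have h2 : ∀ q : Polynomial ℝ, (Polynomial.aeval B q) v = q.eval (1 + x)⁻¹ • v := by
    intro q
    induction q using Polynomial.induction_on' with
    | add p q hp hq =>
      rw [map_add, Polynomial.eval_add, add_smul, ← hp, ← hq]; rfl
    | monomial n a =>
      have h3 : ∀ n : ℕ, (B ^ n) v = ((1 + x)⁻¹) ^ n • v := by
        intro n
        induction n with
        | zero => simp
        | succ n ih =>
          rw [pow_succ']
          change B ((B ^ n) v) = _
          rw [ih, B.map_smul_of_tower, hv, smul_smul, pow_succ]
      rw [Polynomial.aeval_monomial, Polynomial.eval_monomial, mul_smul, ← h3,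
        Algebra.algebraMap_eq_smul_one, smul_mul_assoc, one_mul]
      rfl
  have hx1 : (1 + x)⁻¹ ∈ Set.Icc (0 : ℝ) 1 :=
    ⟨by positivity, inv_le_one_of_one_le₀ (by linarith)⟩
  have h3 : Tendsto (fun n => (p n).eval (1 + x)⁻¹) atTop (𝓝 (Real.exp (-t * x))) := by
    rw [tendsto_iff_norm_sub_tendsto_zero]
    refine squeeze_zero (fun _ => norm_nonneg _) (fun n => ?_)
      tendsto_one_div_add_atTop_nhds_zero_nat
    rw [← heatFun_inv_one_add t hx]
    exact hp n _ hx1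
  refine tendsto_nhds_unique h1 ?_
  refine (h3.smul_const v).congr fun n => ?_
  exact (h2 (p n)).symm

/-- The contribution of an eigenvector `ψ` bounds the quadratic form of `exp (-t A)` from below. -/
theorem le_re_inner_heatOp (hB : IsPosContraction B) {x : ℝ} (hx : 0 ≤ x) {ψ : X} (hψ : ‖ψ‖ = 1)
    (hv : B ψ = (1 + x)⁻¹ • ψ) {t : ℝ} (ht : 0 ≤ t) (u : X) :
    Real.exp (-t * x) * ‖⟪ψ, u⟫_ℂ‖ ^ 2 ≤ (⟪u, heatOp t B u⟫_ℂ).re := by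
  set c := ⟪ψ, u⟫_ℂ with hc
  set w := u - c • ψ with hw
  have hKψ := hB.heatOp_eigenvector hx hv ht
  have hψψ : ⟪ψ, ψ⟫_ℂ = 1 := by rw [inner_self_eq_norm_sq_to_K, hψ]; simp
  have hψw : ⟪ψ, w⟫_ℂ = 0 := by
    rw [hw, inner_sub_right, inner_smul_right, hψψ, ← hc]; simp
  have hwψ : ⟪w, ψ⟫_ℂ = 0 := by rw [← inner_conj_symm, hψw, map_zero]
  have hψKw : ⟪ψ, heatOp t B w⟫_ℂ = 0 := by
    rw [inner_heatOp, hKψ, ← Complex.coe_smul, inner_smul_left, hψw, mul_zero]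
  have hu : u = c • ψ + w := by rw [hw]; abel
  have hKu : heatOp t B u = (Real.exp (-t * x) : ℂ) • c • ψ + heatOp t B w := by
    rw [hu, map_add, map_smul, hKψ, ← Complex.coe_smul, smul_comm]
  have key : ⟪u, heatOp t B u⟫_ℂ
      = ((Real.exp (-t * x) * ‖c‖ ^ 2 : ℝ) : ℂ) + ⟪w, heatOp t B w⟫_ℂ := by
    rw [hKu]
    nth_rewrite 1 [hu]
    rw [inner_add_left, inner_add_right, inner_add_right, inner_smul_left, inner_smul_left,
      inner_smul_right, inner_smul_right, inner_smul_right, inner_smul_right, hψψ, hψKw, hwψ]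
    have : (starRingEnd ℂ) c * c = (‖c‖ ^ 2 : ℝ) := by
      rw [mul_comm, Complex.mul_conj, Complex.normSq_eq_norm_sq]
    push_cast at this ⊢
    linear_combination (Complex.exp (-t * x)) * this
  rw [key, Complex.add_re, Complex.ofReal_re]
  have := re_inner_heatOp_nonneg t B w
  linarith

theorem norm_heatOp_sq (hB : IsPosContraction B) {T : ℝ} (hT : 0 ≤ T) (u : X) :
    ‖heatOp T B u‖ ^ 2 = (⟪u, heatOp (2 * T) B u⟫_ℂ).re := by
  rw [two_mul, ← hB.heatOp_mul hT hT]
  change _ = (⟪u, heatOp T B (heatOp T B u)⟫_ℂ).re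
  rw [inner_heatOp]
  exact (inner_self_eq_norm_sq (𝕜 := ℂ) _).symm

/-- For large `T`, the vector `exp (-T A) u` changes little under `exp (-t A)`. -/
theorem re_inner_heatOp_ge (hB : IsPosContraction B) {T t η : ℝ} (hT : 0 < T) (ht : 0 ≤ t)
    (hη : 0 ≤ η) (u : X) :
    (1 - t * η) * ‖heatOp T B u‖ ^ 2 - Real.exp (-(2 * T) * η) * ‖u‖ ^ 2 ≤
      (⟪heatOp T B u, heatOp t B (heatOp T B u)⟫_ℂ).re := by
  have hT2 : 0 < 2 * T := by linarith
  have h1 : ⟪heatOp T B u, heatOp t B (heatOp T B u)⟫_ℂ = ⟪u, heatOp (2 * T + t) B u⟫_ℂ := by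
    have : heatOp (2 * T + t) B = heatOp T B * (heatOp t B * heatOp T B) := by
      rw [hB.heatOp_mul ht hT.le, hB.heatOp_mul hT.le (by positivity)]
      congr 1; ring
    rw [this, ← inner_heatOp]
    rfl
  rw [h1, hB.norm_heatOp_sq hT.le]
  have hpos : (0 : X →L[ℂ] X) ≤ heatOp (2 * T + t) B -
      ((1 - t * η) • heatOp (2 * T) B - Real.exp (-(2 * T) * η) • 1) := by
    have hsa := hB.isSelfAdjoint
    have c1 := hB.continuousOn_heatFun_spectrum (t := 2 * T + t) (by linarith)
    have c2 := hB.continuousOn_heatFun_spectrum hT2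
    rw [heatOp_of_pos (by linarith), heatOp_of_pos hT2, ← Algebra.algebraMap_eq_smul_one,
      ← cfc_const _ B, ← cfc_const_mul (1 - t * η) _ B c2,
      ← cfc_sub _ _ B (c2.const_mul _) continuousOn_const, sub_nonneg]
    refine cfc_mono (fun b hb => heatFun_add_ge hT2.le ht hη (hB.spectrum_subset hb)) ?_ c1
    exact (c2.const_mul _).sub continuousOn_const
  have h2 := ((ContinuousLinearMap.nonneg_iff_isPositive _).1 hpos).re_inner_nonneg_right u
  change 0 ≤ (⟪u, heatOp (2 * T + t) B u -
    ((1 - t * η) • heatOp (2 * T) B u - Real.exp (-(2 * T) * η) • u)⟫_ℂ).re at h2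
  rw [inner_sub_right, inner_sub_right, ← Complex.coe_smul, ← Complex.coe_smul, inner_smul_right,
    inner_smul_right, Complex.sub_re, Complex.sub_re, Complex.re_ofReal_mul,
    Complex.re_ofReal_mul] at h2
  have h3 : (⟪u, u⟫_ℂ).re = ‖u‖ ^ 2 := inner_self_eq_norm_sq (𝕜 := ℂ) u
  rw [h3] at h2
  linarith

end IsPosContraction

end Op

/-! ### Operators acting fiberwise -/

section Fiberwise

variable {d : ℕ} {𝓗 𝔥 : Type*}
  [NormedAddCommGroup 𝓗] [InnerProductSpace ℂ 𝓗]
  [NormedAddCommGroup 𝔥] [InnerProductSpace ℂ 𝔥]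

/-- The operator `S` acts in the fiber over `P` as `b P`. -/
def ActsFiberwise (V : 𝓗 ≃ₗᵢ[ℂ] Lp 𝔥 2 (volume : Measure (Momentum d)))
    (S : 𝓗 →L[ℂ] 𝓗) (b : Momentum d → 𝔥 →L[ℂ] 𝔥) : Prop :=
  ∀ Φ, V (S Φ) =ᵐ[volume] fun P => b P (V Φ P)

variable {V : 𝓗 ≃ₗᵢ[ℂ] Lp 𝔥 2 (volume : Measure (Momentum d))}

theorem inner_eq_integral (Φ Φ' : 𝓗) : ⟪Φ, Φ'⟫_ℂ = ∫ P, ⟪V Φ P, V Φ' P⟫_ℂ := by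
  rw [← L2.inner_def, V.inner_map_map]

variable (V) in
theorem exists_actsFiberwise {b : Momentum d → 𝔥 →L[ℂ] 𝔥} (hb : Continuous b)
    (hb1 : ∀ P, ‖b P‖ ≤ 1) : ∃ S : 𝓗 →L[ℂ] 𝓗, ActsFiberwise V S b ∧ ‖S‖ ≤ 1 := by
  have hle : ∀ (f : Lp 𝔥 2 (volume : Measure (Momentum d))) (P : Momentum d),
      ‖b P (f P)‖ ≤ ‖f P‖ := fun f P => by
    simpa using (b P).le_of_opNorm_le (hb1 P) (f P)
  have hmem : ∀ f : Lp 𝔥 2 (volume : Measure (Momentum d)),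
      MemLp (fun P => b P (f P)) 2 volume := fun f =>
    (Lp.memLp f).mono (isBoundedBilinearMap_apply.continuous.comp_aestronglyMeasurable
      (hb.aestronglyMeasurable.prodMk (Lp.aestronglyMeasurable f)))
      (ae_of_all _ fun P => hle f P)
  let T0 : Lp 𝔥 2 (volume : Measure (Momentum d)) →ₗ[ℂ] Lp 𝔥 2 (volume : Measure (Momentum d)) :=
    { toFun := fun f => (hmem f).toLp _
      map_add' := fun f g => by
        rw [← MemLp.toLp_add]
        refine MemLp.toLp_congr _ _ ?_
        filter_upwards [Lp.coeFn_add f g] with P hP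
        change b P ((f + g : Lp 𝔥 2 volume) P) = b P (f P) + b P (g P)
        rw [hP, Pi.add_apply, map_add]
      map_smul' := fun c f => by
        rw [RingHom.id_apply, ← MemLp.toLp_const_smul]
        refine MemLp.toLp_congr _ _ ?_
        filter_upwards [Lp.coeFn_smul c f] with P hP
        simp [hP] }
  have hT0 : ∀ f, T0 f =ᵐ[volume] fun P => b P (f P) := fun f => (hmem f).coeFn_toLp
  let T := T0.mkContinuous 1 (fun f => by
    rw [one_mul]
    refine Lp.norm_le_norm_of_ae_le ?_
    filter_upwards [hT0 f] with P hP
    rw [hP]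
    exact hle f P)
  have hT : ‖T‖ ≤ 1 := LinearMap.mkContinuous_norm_le _ zero_le_one _
  let S : 𝓗 →L[ℂ] 𝓗 := (V.symm.toContinuousLinearEquiv.toContinuousLinearMap.comp T).comp
    V.toContinuousLinearEquiv.toContinuousLinearMap
  have hS : ∀ Φ, S Φ = V.symm (T (V Φ)) := fun Φ => rfl
  refine ⟨S, fun Φ => ?_, ContinuousLinearMap.opNorm_le_bound _ zero_le_one fun Φ => ?_⟩
  · rw [hS, LinearIsometryEquiv.apply_symm_apply]
    exact hT0 (V Φ)
  · rw [hS, LinearIsometryEquiv.norm_map]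
    simpa using T.le_of_opNorm_le hT (V Φ)

theorem ActsFiberwise.isResolvent {H : Momentum d → 𝔥 →ₗ.[ℂ] 𝔥} {S : 𝓗 →L[ℂ] 𝓗}
    {b : Momentum d → 𝔥 →L[ℂ] 𝔥} (hS : ActsFiberwise V S b)
    (hb : ∀ P, IsResolvent (H P) (-1) (b P)) : IsResolvent (fiberOperator V H) (-1) S := by
  rw [isResolvent_iff_graph]
  refine ⟨fun Φ => ?_, fun Φ Φ' h => ?_⟩
  · rw [mem_graph_fiberOperator]
    filter_upwards [hS Φ, (by rw [map_add, map_smul]; exact Lp.coeFn_add _ _ :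
      V (Φ + (-1 : ℂ) • S Φ) =ᵐ[volume] V Φ + ((-1 : ℂ) • V (S Φ) :)),
      Lp.coeFn_smul (-1 : ℂ) (V (S Φ))] with P h1 h2 h3
    rw [h2, Pi.add_apply, h3, Pi.smul_apply, h1]
    exact (isResolvent_iff_graph.1 (hb P)).1 _
  · rw [mem_graph_fiberOperator] at h
    refine V.injective (Lp.ext ?_)
    filter_upwards [h, hS (Φ' - (-1 : ℂ) • Φ), (by rw [map_sub, map_smul]; exact Lp.coeFn_sub _ _ :
      V (Φ' - (-1 : ℂ) • Φ) =ᵐ[volume] V Φ' - ((-1 : ℂ) • V Φ :)),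
      Lp.coeFn_smul (-1 : ℂ) (V Φ)] with P h0 h1 h2 h3
    rw [h1, h2, Pi.sub_apply, h3, Pi.smul_apply]
    exact (isResolvent_iff_graph.1 (hb P)).2 _ _ h0

theorem ActsFiberwise.aeval {S : 𝓗 →L[ℂ] 𝓗} {b : Momentum d → 𝔥 →L[ℂ] 𝔥}
    (hS : ActsFiberwise V S b) (p : Polynomial ℝ) :
    ActsFiberwise V (Polynomial.aeval S p) fun P => Polynomial.aeval (b P) p := by
  induction p using Polynomial.induction_on' with
  | add p q hp hq =>
    intro Φ
    have : V (Polynomial.aeval S (p + q) Φ)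
        = V (Polynomial.aeval S p Φ) + V (Polynomial.aeval S q Φ) := by
      rw [map_add (Polynomial.aeval S)]; exact map_add V _ _
    rw [this]
    filter_upwards [hp Φ, hq Φ, Lp.coeFn_add (V (Polynomial.aeval S p Φ))
      (V (Polynomial.aeval S q Φ))] with P h1 h2 h3
    rw [h3, Pi.add_apply, h1, h2, map_add]
    rfl
  | monomial n a =>
    have hpow : ∀ n : ℕ, ActsFiberwise V (S ^ n) fun P => b P ^ n := by
      intro n
      induction n with
      | zero => intro Φ; simp
      | succ n ih =>
        intro Φ
        rw [pow_succ']
        filter_upwards [hS ((S ^ n) Φ), ih Φ] with P h1 h2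
        change V (S ((S ^ n) Φ)) P = _
        rw [h1, h2, pow_succ']
        rfl
    intro Φ
    have h0 : Polynomial.aeval S (Polynomial.monomial n a) Φ = (a : ℂ) • (S ^ n) Φ := by
      rw [Polynomial.aeval_monomial, Algebra.algebraMap_eq_smul_one, smul_mul_assoc, one_mul,
        Complex.coe_smul]
      rfl
    rw [h0, map_smul]
    filter_upwards [hpow n Φ, Lp.coeFn_smul (a : ℂ) (V ((S ^ n) Φ))] with P h1 h2
    rw [h2, Pi.smul_apply, h1, Polynomial.aeval_monomial, Algebra.algebraMap_eq_smul_one,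
      smul_mul_assoc, one_mul, Complex.coe_smul]
    rfl

theorem coeFn_shift (k : Momentum d) (Φ : 𝓗) :
    V (shift V k Φ) =ᵐ[volume] fun P => V Φ (P + k) := by
  have : V (shift V k Φ) = Lp.compMeasurePreserving (fun P : Momentum d => P + k)
      (measurePreserving_add_right volume k) (V Φ) := by
    change V (V.symm _) = _
    rw [LinearIsometryEquiv.apply_symm_apply]
    rfl
  rw [this]
  exact Lp.coeFn_compMeasurePreserving _ _

variable [CompleteSpace 𝓗]

theorem ActsFiberwise.isPositive {S : 𝓗 →L[ℂ] 𝓗} {b : Momentum d → 𝔥 →L[ℂ] 𝔥}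
    (hS : ActsFiberwise V S b) (hb : ∀ P, (b P).IsPositive) : S.IsPositive := by
  rw [ContinuousLinearMap.isPositive_def']
  refine ⟨ContinuousLinearMap.isSelfAdjoint_iff_isSymmetric.2 fun Φ Φ' => ?_, fun Φ => ?_⟩
  · change ⟪S Φ, Φ'⟫_ℂ = ⟪Φ, S Φ'⟫_ℂ
    rw [inner_eq_integral (V := V), inner_eq_integral (V := V)]
    refine integral_congr_ae ?_
    filter_upwards [hS Φ, hS Φ'] with P h1 h2
    rw [h1, h2]
    exact (hb P).isSymmetric _ _
  · change 0 ≤ (⟪S Φ, Φ⟫_ℂ).re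
    have h1 : Integrable (fun P => ⟪V (S Φ) P, V Φ P⟫_ℂ) volume := L2.integrable_inner _ _
    have h2 : (∫ P, ⟪V (S Φ) P, V Φ P⟫_ℂ).re = ∫ P, (⟪V (S Φ) P, V Φ P⟫_ℂ).re :=
      (integral_re h1).symm
    rw [inner_eq_integral (V := V), h2]
    refine integral_nonneg_of_ae ?_
    filter_upwards [hS Φ] with P h1
    rw [h1]
    exact (hb P).re_inner_nonneg_left _

theorem adjoint_shift (k : Momentum d) :
    ContinuousLinearMap.adjoint (shift V k) = shift V (-k) := by
  have h1 : shift V k * shift V (-k) = 1 := by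
    ext Φ
    refine V.injective (Lp.ext ?_)
    change V (shift V k (shift V (-k) Φ)) =ᵐ[volume] V Φ
    have hq :=
      (measurePreserving_add_right (volume : Measure (Momentum d)) k).quasiMeasurePreserving
    have h2 := hq.ae (coeFn_shift (V := V) (-k) Φ)
    filter_upwards [coeFn_shift (V := V) k (shift V (-k) Φ), h2] with P h3 h4
    rw [h3, h4, add_neg_cancel_right]
  have h2 : ContinuousLinearMap.adjoint (shift V k) * shift V k = 1 :=
    ContinuousLinearMap.norm_map_iff_adjoint_comp_self _ |>.1 fun Φ => LinearIsometry.norm_map _ Φ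
  calc ContinuousLinearMap.adjoint (shift V k)
      = ContinuousLinearMap.adjoint (shift V k) * (shift V k * shift V (-k)) := by
        rw [h1, mul_one]
    _ = shift V (-k) := by rw [← mul_assoc, h2, one_mul]

theorem ActsFiberwise.conj_shift {S : 𝓗 →L[ℂ] 𝓗} {b : Momentum d → 𝔥 →L[ℂ] 𝔥}
    (hS : ActsFiberwise V S b) (k : Momentum d) (Φ : 𝓗) :
    V (shift V k (S (ContinuousLinearMap.adjoint (shift V k) Φ))) =ᵐ[volume]
      fun P => b (P + k) (V Φ P) := by
  rw [adjoint_shift]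
  have hq := (measurePreserving_add_right (volume : Measure (Momentum d)) k).quasiMeasurePreserving
  filter_upwards [coeFn_shift (V := V) k (S (shift V (-k) Φ)), hq.ae (hS (shift V (-k) Φ)),
    hq.ae (coeFn_shift (V := V) (-k) Φ)] with P h1 h2 h3
  rw [h1, h2, h3, add_neg_cancel_right]

variable [CompleteSpace 𝔥]

theorem ActsFiberwise.heatOp {S : 𝓗 →L[ℂ] 𝓗} {b : Momentum d → 𝔥 →L[ℂ] 𝔥}
    (hS : ActsFiberwise V S b) (hS1 : IsPosContraction S) (hb : ∀ P, IsPosContraction (b P))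
    {t : ℝ} (ht : 0 ≤ t) : ActsFiberwise V (heatOp t S) fun P => heatOp t (b P) := by
  rcases ht.eq_or_lt with rfl | ht
  · intro Φ
    simp [heatOp_zero]
  intro Φ
  obtain ⟨p, hp⟩ := exists_polynomial_seq_near (continuousOn_heatFun ht)
  have h1 : Tendsto (fun n => V (Polynomial.aeval S (p n) Φ)) atTop
      (𝓝 (V (FiberCLT.heatOp t S Φ))) := by
    rw [heatOp_of_pos ht]
    refine (V.continuous.tendsto _).comp ?_
    exact ((ContinuousLinearMap.apply ℂ 𝓗 Φ).continuous.tendsto _).comp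
      (hS1.tendsto_aeval (continuousOn_heatFun ht) hp)
  obtain ⟨ns, hns, hae⟩ := (tendstoInMeasure_of_tendsto_Lp h1).exists_seq_tendsto_ae
  have hall : ∀ᵐ P, ∀ n, V (Polynomial.aeval S (p n) Φ) P = Polynomial.aeval (b P) (p n) (V Φ P) :=
    ae_all_iff.2 fun n => hS.aeval (p n) Φ
  filter_upwards [hae, hall] with P h2 h3
  refine tendsto_nhds_unique h2 ?_
  simp only [h3]
  rw [heatOp_of_pos ht]
  exact ((ContinuousLinearMap.apply ℂ 𝔥 (V Φ P)).continuous.tendsto _).comp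
      (((hb P).tendsto_aeval (continuousOn_heatFun ht) hp).comp hns.tendsto_atTop)

/-- The characteristic function in terms of the fibers. -/
theorem charFunTilde_eq_integral {H : Momentum d → 𝔥 →ₗ.[ℂ] 𝔥} {b : Momentum d → 𝔥 →L[ℂ] 𝔥}
    (hb : Continuous b) (hH : ∀ P, IsInvOneAdd (H P) (b P)) (φ : 𝓗) {T t : ℝ} (hT : 0 ≤ T)
    (ht : 0 ≤ t) (k : Momentum d) :
    Integrable (fun P => (⟪heatOp T (b P) (V φ P),
      heatOp t (b (P + k)) (heatOp T (b P) (V φ P))⟫_ℂ).re) ∧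
    charFunTilde V H φ T k t = ((∫ P, (⟪heatOp T (b P) (V φ P),
      heatOp t (b (P + k)) (heatOp T (b P) (V φ P))⟫_ℂ).re : ℝ) : ℂ) := by
  obtain ⟨S, hS, hS1⟩ := exists_actsFiberwise V hb fun P => (hH P).norm_le_one
  have hSp : IsPosContraction S := ⟨hS.isPositive fun P => (hH P).isPositive, hS1⟩
  have hR := hS.isResolvent fun P => (hH P).isResolvent
  have hK : ∀ {s : ℝ}, 0 ≤ s →
      ActsFiberwise V (FiberCLT.heatOp s S) fun P => FiberCLT.heatOp s (b P) :=
    fun hs => hS.heatOp hSp (fun P => (hH P).isPosContraction) hs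
  set Ψ := FiberCLT.heatOp T S φ with hΨ
  set Ω := shift V k (FiberCLT.heatOp t S (ContinuousLinearMap.adjoint (shift V k) Ψ)) with hΩ
  have h1 : charFunTilde V H φ T k t = ∫ P, ⟪V Ψ P, V Ω P⟫_ℂ := by
    rw [charFunTilde, expNeg_eq_heatOp T hR, expNeg_eq_heatOp t hR, inner_heatOp,
      inner_eq_integral (V := V)]
  have hint : Integrable (fun P => ⟪V Ψ P, V Ω P⟫_ℂ) := L2.integrable_inner _ _
  have hae : (fun P => ⟪V Ψ P, V Ω P⟫_ℂ) =ᵐ[volume] fun P => (((⟪heatOp T (b P) (V φ P),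
      heatOp t (b (P + k)) (heatOp T (b P) (V φ P))⟫_ℂ).re : ℝ) : ℂ) := by
    filter_upwards [hK hT φ, (hK ht).conj_shift k Ψ] with P e1 e2
    rw [e2, e1]
    exact ((isPositive_heatOp t _).isSymmetric.coe_re_inner_self_apply _).symm
  have hint2 := hint.congr hae
  refine ⟨by simpa using hint2.re, ?_⟩
  rw [h1, integral_congr_ae hae]
  exact integral_ofReal

end Fiberwise

/-! ### Concentration at the minima of the energy -/

section Concentration

variable {d : ℕ}

/-- What the argument uses of the densities
`F T k t P = ⟨u, exp (-t H(P + k)) u⟩`, `u = exp (-T H(P)) φ_P`, whose integral over `P` is the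
unnormalized characteristic function. Here `E P` is the bottom of the spectrum of `H(P)` and
`N P = ‖φ_P‖ ^ 2`; note `F T 0 0 P = ‖u‖ ^ 2`. The field `lower` holds for `P` close to a minimum
of `E`, since there `φ_P` overlaps with the ground state. -/
structure IsHeatDensity (E N : Momentum d → ℝ)
    (F : ℝ → Momentum d → ℝ → Momentum d → ℝ) : Prop where
  continuous : Continuous E
  energy_nonneg : ∀ P, 0 ≤ E P
  coercive : ∃ δ > 0, ∀ᶠ P in cocompact (Momentum d), δ ≤ E P
  exists_zero : ∃ P, E P = 0
  integrable_N : Integrable N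
  N_nonneg : ∀ P, 0 ≤ N P
  integrable : ∀ {T t : ℝ} (k : Momentum d), 0 ≤ T → 0 ≤ t → Integrable (F T k t)
  nonneg : ∀ T k t P, 0 ≤ F T k t P
  le : ∀ {T t : ℝ} (k P : Momentum d), 0 ≤ T → 0 ≤ t →
    F T k t P ≤ Real.exp (-t * E (P + k)) * F T 0 0 P
  le_N : ∀ {T : ℝ} (P : Momentum d), 0 ≤ T → F T 0 0 P ≤ Real.exp (-(2 * T) * E P) * N P
  ge : ∀ {T t η : ℝ} (P : Momentum d), 0 < T → 0 ≤ t → 0 ≤ η →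
    (1 - t * η) * F T 0 0 P - Real.exp (-(2 * T) * η) * N P ≤ F T 0 t P
  lower : ∀ P₀, E P₀ = 0 → ∃ r > 0, ∃ c > 0, ∃ C > 0, ∀ᵐ P, P ∈ Metric.ball P₀ r → N P ≤ C ∧
    ∀ T, 0 ≤ T → c * Real.exp (-(2 * T) * E P) ≤ F T 0 0 P ∧ ∀ t, 0 ≤ t → ∀ k, ‖k‖ < r →
      c * Real.exp (-t * E (P + k)) * F T 0 0 P ≤ F T k t P

/-- The squared norm of `exp (-T H) φ`. -/
def mass (F : ℝ → Momentum d → ℝ → Momentum d → ℝ) (T : ℝ) : ℝ := ∫ P, F T 0 0 P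

/-- The squared norm of the part of `exp (-T H) φ` with momentum in `A`. -/
def massOn (F : ℝ → Momentum d → ℝ → Momentum d → ℝ) (T : ℝ) (A : Set (Momentum d)) : ℝ :=
  ∫ P in A, F T 0 0 P

/-- For arbitrarily large `T`, a fixed fraction of the mass of `exp (-T H) φ` is near `P₀`. -/
def IsHeavy (F : ℝ → Momentum d → ℝ → Momentum d → ℝ) (P₀ : Momentum d) : Prop :=
  ∀ r > 0, ∃ w > 0, ∃ᶠ T in atTop, w * mass F T ≤ massOn F T (Metric.ball P₀ r)

namespace IsHeatDensity

variable {E N : Momentum d → ℝ} {F : ℝ → Momentum d → ℝ → Momentum d → ℝ}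

theorem exists_gap (h : IsHeatDensity E N F) {W : Set (Momentum d)} (hW : IsOpen W)
    (hZ : ∀ P, E P = 0 → P ∈ W) : ∃ δ > 0, ∀ P, P ∉ W → δ ≤ E P := by
  obtain ⟨δ, hδ, hE⟩ := h.coercive
  obtain ⟨K, hK, hKE⟩ := mem_cocompact.1 hE
  have hKW : IsCompact (K ∩ Wᶜ) := hK.inter_right hW.isClosed_compl
  rcases (K ∩ Wᶜ).eq_empty_or_nonempty with he | hne
  · refine ⟨δ, hδ, fun P hP => hKE fun hPK => ?_⟩
    exact (he ▸ (⟨hPK, hP⟩ : P ∈ K ∩ Wᶜ) : P ∈ (∅ : Set _))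
  · obtain ⟨P₁, hP₁, hmin⟩ := hKW.exists_isMinOn hne h.continuous.continuousOn
    have hpos : 0 < E P₁ := lt_of_le_of_ne (h.energy_nonneg P₁) fun h0 => hP₁.2 (hZ _ h0.symm)
    refine ⟨min δ (E P₁), lt_min hδ hpos, fun P hP => ?_⟩
    by_cases hPK : P ∈ K
    · exact (min_le_right _ _).trans (hmin ⟨hPK, hP⟩)
    · exact (min_le_left _ _).trans (hKE hPK)

theorem massOn_mono (h : IsHeatDensity E N F) {T : ℝ} (hT : 0 ≤ T) {A B : Set (Momentum d)}
    (hAB : A ⊆ B) : massOn F T A ≤ massOn F T B :=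
  setIntegral_mono_set (h.integrable 0 hT le_rfl).integrableOn
    (ae_of_all _ fun P => h.nonneg T 0 0 P) (ae_of_all _ hAB)

theorem massOn_le_mass (h : IsHeatDensity E N F) {T : ℝ} (hT : 0 ≤ T) (A : Set (Momentum d)) :
    massOn F T A ≤ mass F T := by
  have := h.massOn_mono hT (Set.subset_univ A)
  rwa [massOn, massOn, setIntegral_univ] at this

theorem massOn_add_compl (h : IsHeatDensity E N F) {T : ℝ} (hT : 0 ≤ T) {A : Set (Momentum d)}
    (hA : MeasurableSet A) : massOn F T A + massOn F T Aᶜ = mass F T :=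
  integral_add_compl hA (h.integrable 0 hT le_rfl)

theorem massOn_union_le (h : IsHeatDensity E N F) {T : ℝ} (hT : 0 ≤ T) {A B : Set (Momentum d)}
    (hA : MeasurableSet A) : massOn F T (A ∪ B) ≤ massOn F T A + massOn F T B := by
  have hi : IntegrableOn (F T 0 0) (A ∪ B) := (h.integrable 0 hT le_rfl).integrableOn
  have h1 := (integral_inter_add_sdiff hA hi).symm
  have h2 := h.massOn_mono hT (A := (A ∪ B) ∩ A) (B := A) Set.inter_subset_right
  have h3 := h.massOn_mono hT (A := (A ∪ B) \ A) (B := B) (by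
    rintro P ⟨h1 | h1, h2⟩
    exacts [absurd h1 h2, h1])
  unfold massOn at *
  linarith

theorem massOn_biUnion_le (h : IsHeatDensity E N F) {T : ℝ} (hT : 0 ≤ T) {ι : Type*}
    (s : Finset ι) {A : ι → Set (Momentum d)} (hA : ∀ i, MeasurableSet (A i)) :
    massOn F T (⋃ i ∈ s, A i) ≤ ∑ i ∈ s, massOn F T (A i) := by
  classical
  induction s using Finset.induction_on with
  | empty => simp [massOn]
  | insert i s hi ih =>
    rw [Finset.set_biUnion_insert, Finset.sum_insert hi]
    exact (h.massOn_union_le hT (hA i)).trans (by linarith)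

/-- The mass decays slower than any exponential, since `E` is arbitrarily small near its minima. -/
theorem exists_le_mass (h : IsHeatDensity E N F) {δ : ℝ} (hδ : 0 < δ) :
    ∃ c > 0, ∀ T, 0 ≤ T → c * Real.exp (-δ * T) ≤ mass F T := by
  obtain ⟨P₀, hP₀⟩ := h.exists_zero
  obtain ⟨r, hr, c, hc, C, hC, hlow⟩ := h.lower P₀ hP₀
  set A := Metric.ball P₀ r ∩ {P | E P < δ / 2} with hA
  have hAo : IsOpen A := Metric.isOpen_ball.inter (isOpen_lt h.continuous continuous_const)
  have hAne : A.Nonempty := ⟨P₀, Metric.mem_ball_self hr, by simp [hP₀, hδ]⟩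
  have hAfin : volume A ≠ ⊤ :=
    ((measure_mono Set.inter_subset_left).trans_lt measure_ball_lt_top).ne
  have hv : 0 < volume.real A := ENNReal.toReal_pos (hAo.measure_pos _ hAne).ne' hAfin
  refine ⟨c * volume.real A, by positivity, fun T hT => ?_⟩
  refine le_trans ?_ (h.massOn_le_mass hT A)
  have h1 : ∫ _ in A, c * Real.exp (-δ * T) = c * volume.real A * Real.exp (-δ * T) := by
    rw [setIntegral_const, smul_eq_mul]; ring
  rw [← h1]
  refine setIntegral_mono_on_ae (integrableOn_const hAfin)
    (h.integrable 0 hT le_rfl).integrableOn hAo.measurableSet ?_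
  filter_upwards [hlow] with P hP hPA
  refine le_trans ?_ ((hP hPA.1).2 T hT).1
  have : E P < δ / 2 := hPA.2
  have : Real.exp (-δ * T) ≤ Real.exp (-(2 * T) * E P) := Real.exp_le_exp.2 (by nlinarith)
  gcongr

theorem mass_pos (h : IsHeatDensity E N F) {T : ℝ} (hT : 0 ≤ T) : 0 < mass F T := by
  obtain ⟨c, hc, hm⟩ := h.exists_le_mass one_pos
  exact lt_of_lt_of_le (by positivity) (hm T hT)

theorem eventually_exp_le_mass (h : IsHeatDensity E N F) {δ η : ℝ} (hδ : 0 < δ) (hη : 0 < η) :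
    ∀ᶠ T in atTop, Real.exp (-(2 * T) * δ) * ∫ P, N P ≤ η * mass F T := by
  obtain ⟨c, hc, hm⟩ := h.exists_le_mass hδ
  have hN : 0 ≤ ∫ P, N P := integral_nonneg h.N_nonneg
  have h1 : Tendsto (fun T : ℝ => Real.exp (-δ * T) * ∫ P, N P) atTop (𝓝 0) := by
    have : Tendsto (fun T : ℝ => -δ * T) atTop atBot :=
      tendsto_id.const_mul_atTop_of_neg (by linarith)
    simpa using (Real.tendsto_exp_atBot.comp this).mul_const (∫ P, N P)
  filter_upwards [h1.eventually_lt_const (mul_pos hη hc), eventually_ge_atTop 0] with T h2 hT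
  have h3 := hm T hT
  have h4 : Real.exp (-(2 * T) * δ) = Real.exp (-δ * T) * Real.exp (-δ * T) := by
    rw [← Real.exp_add]; ring_nf
  rw [h4]
  have h5 := Real.exp_pos (-δ * T)
  calc Real.exp (-δ * T) * Real.exp (-δ * T) * ∫ P, N P
      = Real.exp (-δ * T) * (Real.exp (-δ * T) * ∫ P, N P) := by ring
    _ ≤ Real.exp (-δ * T) * (η * c) := by gcongr
    _ = η * (c * Real.exp (-δ * T)) := by ring
    _ ≤ η * mass F T := by gcongr

/-- The mass concentrates at the minima of `E`. -/
theorem eventually_massOn_compl_le (h : IsHeatDensity E N F) {W : Set (Momentum d)}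
    (hW : IsOpen W) (hZ : ∀ P, E P = 0 → P ∈ W) {η : ℝ} (hη : 0 < η) :
    ∀ᶠ T in atTop, massOn F T Wᶜ ≤ η * mass F T := by
  obtain ⟨δ, hδ, hE⟩ := h.exists_gap hW hZ
  filter_upwards [h.eventually_exp_le_mass hδ hη, eventually_ge_atTop 0] with T h1 hT
  refine le_trans ?_ h1
  have hi : Integrable fun P => Real.exp (-(2 * T) * δ) * N P := h.integrable_N.const_mul _
  rw [← integral_const_mul]
  refine le_trans ?_ (setIntegral_le_integral (s := Wᶜ) hi (ae_of_all _ fun P =>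
    mul_nonneg (Real.exp_nonneg _) (h.N_nonneg P)))
  refine setIntegral_mono_on (h.integrable 0 hT le_rfl).integrableOn hi.integrableOn
    hW.isClosed_compl.measurableSet fun P hP => (h.le_N P hT).trans ?_
  have := h.N_nonneg P
  have : Real.exp (-(2 * T) * E P) ≤ Real.exp (-(2 * T) * δ) :=
    Real.exp_le_exp.2 (by nlinarith [hE P hP])
  gcongr

/-- The ratio of `⟨φ, exp (-(2 T + t) H) φ⟩` and `⟨φ, exp (-2 T H) φ⟩` tends to `1`. -/
theorem eventually_mul_mass_le (h : IsHeatDensity E N F) {t θ : ℝ} (ht : 0 ≤ t) (hθ : 0 < θ) :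
    ∀ᶠ T in atTop, (1 - θ) * mass F T ≤ ∫ P, F T 0 t P := by
  set η := θ / (2 * (t + 1)) with hη
  have hη0 : 0 < η := by positivity
  have htη : t * η ≤ θ / 2 := by
    rw [hη, mul_div_assoc', div_le_div_iff₀ (by positivity) (by positivity)]
    nlinarith
  filter_upwards [h.eventually_exp_le_mass hη0 (half_pos hθ), eventually_gt_atTop 0] with T h1 hT
  have hm := h.mass_pos hT.le
  have hi1 : Integrable fun P => (1 - t * η) * F T 0 0 P :=
    (h.integrable 0 hT.le le_rfl).const_mul _
  have hi2 : Integrable fun P => Real.exp (-(2 * T) * η) * N P := h.integrable_N.const_mul _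
  have h2 : ∫ P, ((1 - t * η) * F T 0 0 P - Real.exp (-(2 * T) * η) * N P) ≤ ∫ P, F T 0 t P :=
    integral_mono (hi1.sub hi2) (h.integrable 0 hT.le ht) fun P => h.ge P hT ht hη0.le
  rw [integral_sub hi1 hi2, integral_const_mul, integral_const_mul] at h2
  change (1 - t * η) * mass F T - _ ≤ _ at h2
  nlinarith

theorem integral_zero_le_mass (h : IsHeatDensity E N F) {T t : ℝ} (hT : 0 ≤ T) (ht : 0 ≤ t) :
    ∫ P, F T 0 t P ≤ mass F T := by
  refine integral_mono (h.integrable 0 hT ht) (h.integrable 0 hT le_rfl) fun P => ?_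
  refine (h.le 0 P hT ht).trans (mul_le_of_le_one_left (h.nonneg _ _ _ _) ?_)
  rw [Real.exp_le_one_iff]
  nlinarith [h.energy_nonneg (P + 0)]

/-- Some minimum of `E` is heavy, by compactness of the set of minima. -/
theorem exists_isHeavy (h : IsHeatDensity E N F) : ∃ P₀, E P₀ = 0 ∧ IsHeavy F P₀ := by
  by_contra! hcon
  have hcon' : ∀ P₀, E P₀ = 0 → ∃ r > 0, ∀ w > 0, ∀ᶠ T in atTop,
      massOn F T (Metric.ball P₀ r) < w * mass F T := by
    intro P₀ hP₀
    have := hcon P₀ hP₀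
    unfold IsHeavy at this
    push Not at this
    exact this
  choose! r hr hlt using hcon'
  set Z := {P | E P = 0} with hZdef
  have hZ : IsCompact Z := by
    obtain ⟨δ, hδ, hE⟩ := h.coercive
    obtain ⟨K, hK, hKE⟩ := mem_cocompact.1 hE
    refine hK.of_isClosed_subset (isClosed_eq h.continuous continuous_const) fun P hP => ?_
    by_contra hPK
    have h1 : δ ≤ E P := hKE hPK
    have h2 : E P = 0 := hP
    linarith
  obtain ⟨s, hsZ, hs⟩ := hZ.elim_nhds_subcover (fun P => Metric.ball P (r P))
    fun P hP => Metric.ball_mem_nhds P (hr P hP)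
  set W := ⋃ P ∈ s, Metric.ball P (r P) with hWdef
  have hW : IsOpen W := isOpen_biUnion fun P _ => Metric.isOpen_ball
  set w : ℝ := 1 / (4 * (s.card + 1)) with hw
  have hw0 : 0 < w := by positivity
  have h1 : ∀ᶠ T in atTop, ∀ P ∈ s, massOn F T (Metric.ball P (r P)) < w * mass F T :=
    (eventually_all_finset s).2 fun P hP => hlt P (hsZ P hP) w hw0
  have h2 := h.eventually_massOn_compl_le hW (fun P hP => hs hP) (η := 1 / 4) (by norm_num)
  obtain ⟨T, h1, h2, hT⟩ := (h1.and (h2.and (eventually_ge_atTop 0))).exists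
  have h3 := h.massOn_add_compl hT hW.measurableSet
  have h4 := h.massOn_biUnion_le hT s (A := fun P => Metric.ball P (r P))
    fun P => Metric.isOpen_ball.measurableSet
  have h5 : ∑ P ∈ s, massOn F T (Metric.ball P (r P)) ≤ s.card * (w * mass F T) := by
    rw [← nsmul_eq_mul]
    exact Finset.sum_le_card_nsmul _ _ _ fun P hP => (h1 P hP).le
  have h6 : (s.card : ℝ) * w ≤ 1 / 4 := by
    rw [hw, mul_one_div, div_le_div_iff₀ (by positivity) (by positivity)]
    linarith
  have hm := h.mass_pos hT
  have h7 : massOn F T W ≤ s.card * (w * mass F T) := h4.trans h5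
  nlinarith

end IsHeatDensity

end Concentration

/-! ### Consequences of the central limit theorem -/

section CLT

variable {d : ℕ}

/-- The central limit theorem for the densities `F`, in terms of real numbers. -/
def DensityCLT (F : ℝ → Momentum d → ℝ → Momentum d → ℝ) (σ : ℝ) : Prop :=
  ∃ G : Momentum d → ℝ → ℝ,
    (∀ (k : Momentum d) (t : ℝ), 0 ≤ t →
      Tendsto (fun T : ℝ => (∫ P, F T k t P) / ∫ P, F T 0 t P) atTop (𝓝 (G k t))) ∧
    ∀ (k : Momentum d) (t : ℝ), 0 ≤ t →
      Tendsto (fun ε : ℝ => G (ε • k) ((ε ^ 2)⁻¹ * t)) (𝓝[>] 0)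
        (𝓝 (Real.exp (-(1 / 2) * σ ^ 2 * ‖k‖ ^ 2 * t)))

theorem le_of_forall_mul_exp_le {w a κ : ℝ} (hw : 0 < w)
    (h : ∀ t : ℝ, 0 ≤ t → w * Real.exp (-κ * t) ≤ Real.exp (-a * t)) : a ≤ κ := by
  by_contra! hlt
  have h1 : Tendsto (fun t : ℝ => Real.exp ((κ - a) * t)) atTop (𝓝 0) :=
    Real.tendsto_exp_atBot.comp (tendsto_id.const_mul_atTop_of_neg (by linarith))
  obtain ⟨t, h2, ht⟩ := ((h1.eventually_lt_const hw).and (eventually_ge_atTop 0)).exists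
  have h3 := h t ht
  have h4 : Real.exp (-a * t) = Real.exp ((κ - a) * t) * Real.exp (-κ * t) := by
    rw [← Real.exp_add]; ring_nf
  rw [h4] at h3
  exact absurd (le_of_mul_le_mul_right h3 (Real.exp_pos _)) (not_le.2 h2)

theorem eventually_norm_smul_lt (k : Momentum d) {r : ℝ} (hr : 0 < r) :
    ∀ᶠ ε : ℝ in 𝓝[>] 0, ‖ε • k‖ < r := by
  have : Tendsto (fun ε : ℝ => ‖ε • k‖) (𝓝[>] 0) (𝓝 0) := by
    have : Tendsto (fun ε : ℝ => ‖ε • k‖) (𝓝 0) (𝓝 ‖(0 : ℝ) • k‖) := by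
      exact Continuous.tendsto (by fun_prop) 0
    rw [zero_smul, norm_zero] at this
    exact this.mono_left nhdsWithin_le_nhds
  exact this.eventually_lt_const hr

namespace IsHeatDensity

variable {E N : Momentum d → ℝ} {F : ℝ → Momentum d → ℝ → Momentum d → ℝ} {σ : ℝ}

/-- If `E (P + ε k) < κ ε²` at the minima `P` near a heavy minimum `P₀`, the ground states with
momentum near `P₀` contribute at least a fixed multiple of `exp (-κ t)` to the rescaled
characteristic function, for all `t`. So this function cannot decay faster than `exp (-κ t)`. -/
theorem le_of_isHeavy (h : IsHeatDensity E N F) (hF : DensityCLT F σ) {P₀ : Momentum d}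
    (h0 : E P₀ = 0) (hP₀ : IsHeavy F P₀) {k : Momentum d} {κ r₀ : ℝ} (hr₀ : 0 < r₀)
    (hκ : ∀ᶠ ε : ℝ in 𝓝[>] 0, ∀ P ∈ Metric.closedBall P₀ r₀, E P = 0 →
      E (P + ε • k) < κ * ε ^ 2) : σ ^ 2 * ‖k‖ ^ 2 / 2 ≤ κ := by
  obtain ⟨G, hG1, hG2⟩ := hF
  obtain ⟨r₁, hr₁, c, hc, C, hC, hlow⟩ := h.lower P₀ h0
  set r := min r₀ r₁ with hr
  have hr0 : 0 < r := lt_min hr₀ hr₁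
  obtain ⟨w, hw, hfreq⟩ := hP₀ r hr0
  refine le_of_forall_mul_exp_le (w := c * (w / 2)) (by positivity) fun t ht => ?_
  have hG2' := hG2 k t ht
  have e1 : -(σ ^ 2 * ‖k‖ ^ 2 / 2) * t = -(1 / 2) * σ ^ 2 * ‖k‖ ^ 2 * t := by ring
  rw [e1]
  refine ge_of_tendsto hG2' ?_
  filter_upwards [hκ, eventually_norm_smul_lt k hr₁, self_mem_nhdsWithin] with ε hε hεr hε0
  have hε0 : 0 < ε := hε0
  have hs : 0 ≤ (ε ^ 2)⁻¹ * t := by positivity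
  set s := (ε ^ 2)⁻¹ * t with hsdef
  refine le_of_tendsto_of_tendsto_of_frequently tendsto_const_nhds (hG1 (ε • k) s hs) ?_
  -- the set of momenta where the shifted energy is small, made global by allowing everything
  -- outside the closed ball
  set W : Set (Momentum d) := {P | E (P + ε • k) < κ * ε ^ 2} ∪ (Metric.closedBall P₀ r₀)ᶜ
    with hWdef
  have hWo : IsOpen W := by
    refine IsOpen.union (isOpen_lt ?_ continuous_const) Metric.isClosed_closedBall.isOpen_compl
    exact h.continuous.comp (by fun_prop)
  have hWZ : ∀ P, E P = 0 → P ∈ W := fun P hP => by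
    by_cases hPb : P ∈ Metric.closedBall P₀ r₀
    exacts [Or.inl (hε P hPb hP), Or.inr hPb]
  have hout := h.eventually_massOn_compl_le hWo hWZ (half_pos hw)
  have hden := h.eventually_mul_mass_le hs one_half_pos
  refine (hfreq.and_eventually (hout.and (hden.and (eventually_ge_atTop 0)))).mono ?_
  rintro T ⟨h1, h2, hd, hT⟩
  set B := Metric.ball P₀ r with hB
  have hm := h.mass_pos hT
  have h3 : massOn F T B ≤ massOn F T (B ∩ W) + massOn F T Wᶜ := by
    refine (h.massOn_mono hT ?_).trans
      (h.massOn_union_le hT (Metric.isOpen_ball.inter hWo).measurableSet)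
    intro P hP
    by_cases hPW : P ∈ W
    exacts [Or.inl ⟨hP, hPW⟩, Or.inr hPW]
  have h4 : w / 2 * mass F T ≤ massOn F T (B ∩ W) := by linarith
  have h5 : c * Real.exp (-κ * t) * massOn F T (B ∩ W) ≤ ∫ P, F T (ε • k) s P := by
    refine le_trans ?_ (setIntegral_le_integral (s := B ∩ W) (h.integrable _ hT hs)
      (ae_of_all _ fun P => h.nonneg _ _ _ _))
    rw [massOn, ← integral_const_mul]
    refine setIntegral_mono_on_ae ((h.integrable 0 hT le_rfl).const_mul _).integrableOn
      (h.integrable _ hT hs).integrableOn (Metric.isOpen_ball.inter hWo).measurableSet ?_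
    filter_upwards [hlow] with P hP hPBW
    have hPr₁ : P ∈ Metric.ball P₀ r₁ := Metric.ball_subset_ball (min_le_right _ _) hPBW.1
    have hPr₀ : P ∈ Metric.closedBall P₀ r₀ :=
      Metric.ball_subset_closedBall (Metric.ball_subset_ball (min_le_left _ _) hPBW.1)
    have hPE : E (P + ε • k) < κ * ε ^ 2 := hPBW.2.resolve_right fun hn => hn hPr₀
    refine le_trans ?_ (((hP hPr₁).2 T hT).2 s hs (ε • k) hεr)
    have h6 := h.nonneg T 0 0 P
    have h7 : Real.exp (-κ * t) ≤ Real.exp (-s * E (P + ε • k)) := by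
      refine Real.exp_le_exp.2 ?_
      have : s * E (P + ε • k) ≤ s * (κ * ε ^ 2) := by gcongr
      have e : s * (κ * ε ^ 2) = κ * t := by rw [hsdef]; field_simp
      linarith
    gcongr
  have h8 := h.integral_zero_le_mass hT hs
  have hdpos : 0 < ∫ P, F T 0 s P := by linarith
  have h9 : c * (w / 2) * Real.exp (-κ * t) * mass F T ≤ ∫ P, F T (ε • k) s P := by
    refine le_trans ?_ h5
    calc c * (w / 2) * Real.exp (-κ * t) * mass F T
        = c * Real.exp (-κ * t) * (w / 2 * mass F T) := by ring
      _ ≤ _ := by gcongr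
  rw [le_div_iff₀ hdpos]
  refine le_trans ?_ h9
  gcongr

/-- An upper bound on the rescaled characteristic function: if `P₁` is a heavy minimum, for
arbitrarily large `T` at least a fixed fraction `w` of the mass is near `P₁`, where the decay rate
is at least `κ₁`, and the rest is near the other minima, where it is at least `κ₀`. -/
theorem exp_le_of_isHeavy (h : IsHeatDensity E N F) (hF : DensityCLT F σ) {P₁ : Momentum d}
    (hP₁ : IsHeavy F P₁) {r : ℝ} (hr : 0 < r) : ∃ w > 0, w ≤ 1 ∧
    ∀ (k : Momentum d) (κ₀ κ₁ t : ℝ), κ₀ ≤ κ₁ → 0 ≤ t →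
      (∀ᶠ ε : ℝ in 𝓝[>] 0, (∀ P, E P = 0 → κ₀ * ε ^ 2 < E (P + ε • k)) ∧
        ∀ P ∈ Metric.closedBall P₁ r, E P = 0 → κ₁ * ε ^ 2 < E (P + ε • k)) →
      Real.exp (-(1 / 2) * σ ^ 2 * ‖k‖ ^ 2 * t) ≤
        (1 - w) * Real.exp (-κ₀ * t) + w * Real.exp (-κ₁ * t) := by
  obtain ⟨G, hG1, hG2⟩ := hF
  obtain ⟨w, hw, hfreq⟩ := hP₁ r hr
  have hw1 : w ≤ 1 := by
    obtain ⟨T, h1, hT⟩ := (hfreq.and_eventually (eventually_ge_atTop 0)).exists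
    have h2 := h1.trans (h.massOn_le_mass hT _)
    have := h.mass_pos hT
    nlinarith
  refine ⟨w, hw, hw1, fun k κ₀ κ₁ t hκ ht hε => ?_⟩
  set D := (1 - w) * Real.exp (-κ₀ * t) + w * Real.exp (-κ₁ * t) with hD
  have hD0 : 0 ≤ D := add_nonneg (mul_nonneg (by linarith) (Real.exp_nonneg _)) (by positivity)
  refine le_of_tendsto (hG2 k t ht) ?_
  filter_upwards [hε, self_mem_nhdsWithin] with ε hε hε0
  have hε0 : 0 < ε := hε0
  have hs : 0 ≤ (ε ^ 2)⁻¹ * t := by positivity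
  set s := (ε ^ 2)⁻¹ * t with hsdef
  set W : Set (Momentum d) := {P | κ₀ * ε ^ 2 < E (P + ε • k)} ∩
    ({P | κ₁ * ε ^ 2 < E (P + ε • k)} ∪ (Metric.closedBall P₁ r)ᶜ) with hWdef
  have hcont : Continuous fun P => E (P + ε • k) := h.continuous.comp (by fun_prop)
  have hWo : IsOpen W := (isOpen_lt continuous_const hcont).inter
    ((isOpen_lt continuous_const hcont).union Metric.isClosed_closedBall.isOpen_compl)
  have hWZ : ∀ P, E P = 0 → P ∈ W := fun P hP => by
    refine ⟨hε.1 P hP, ?_⟩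
    by_cases hPb : P ∈ Metric.closedBall P₁ r
    exacts [Or.inl (hε.2 P hPb hP), Or.inr hPb]
  -- it suffices to bound the characteristic function by `(D + θ) / (1 - θ)`
  have key : ∀ θ : ℝ, 0 < θ → θ < 1 → G (ε • k) s * (1 - θ) ≤ D + θ := by
    intro θ hθ hθ1
    rw [← le_div_iff₀ (by linarith)]
    refine le_of_tendsto_of_frequently (hG1 (ε • k) s hs) ?_
    have hout := h.eventually_massOn_compl_le hWo hWZ hθ
    have hden := h.eventually_mul_mass_le hs hθ
    refine (hfreq.and_eventually (hout.and (hden.and (eventually_ge_atTop 0)))).mono ?_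
    rintro T ⟨h1, h2, h3, hT⟩
    have hm := h.mass_pos hT
    set B := Metric.ball P₁ r with hB
    set e₀ := Real.exp (-κ₀ * t) with he₀
    set e₁ := Real.exp (-κ₁ * t) with he₁
    have he : e₁ ≤ e₀ := Real.exp_le_exp.2 (by nlinarith)
    have he₁0 : 0 < e₁ := Real.exp_pos _
    have hU := h.integrable (T := T) 0 hT (le_refl (0 : ℝ))
    have hexp : ∀ κ P, κ * ε ^ 2 < E (P + ε • k) →
        F T (ε • k) s P ≤ Real.exp (-κ * t) * F T 0 0 P := by
      intro κ P hP
      refine (h.le _ P hT hs).trans ?_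
      have h6 := h.nonneg T 0 0 P
      have h7 : Real.exp (-s * E (P + ε • k)) ≤ Real.exp (-κ * t) := by
        refine Real.exp_le_exp.2 ?_
        have : s * (κ * ε ^ 2) ≤ s * E (P + ε • k) := by gcongr
        have e : s * (κ * ε ^ 2) = κ * t := by rw [hsdef]; field_simp
        linarith
      gcongr
    have hBm : MeasurableSet B := Metric.isOpen_ball.measurableSet
    have hbound : ∀ P, F T (ε • k) s P ≤ e₀ * F T 0 0 P - (e₀ - e₁) * B.indicator (F T 0 0) P +
        Wᶜ.indicator (F T 0 0) P := by
      intro P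
      have h6 := h.nonneg T 0 0 P
      by_cases hPW : P ∈ W
      · rw [Set.indicator_of_notMem (s := Wᶜ) (fun hn => hn hPW), add_zero]
        by_cases hPB : P ∈ B
        · rw [Set.indicator_of_mem hPB]
          have := hexp κ₁ P (hPW.2.resolve_right fun hn => hn (Metric.ball_subset_closedBall hPB))
          linarith
        · rw [Set.indicator_of_notMem hPB, mul_zero, sub_zero]
          exact hexp κ₀ P hPW.1
      · rw [Set.indicator_of_mem (show P ∈ Wᶜ from hPW)]
        have h8 : F T (ε • k) s P ≤ F T 0 0 P := by
          refine (h.le _ P hT hs).trans (mul_le_of_le_one_left h6 ?_)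
          rw [Real.exp_le_one_iff]
          nlinarith [h.energy_nonneg (P + ε • k)]
        have h9 : B.indicator (F T 0 0) P ≤ F T 0 0 P := Set.indicator_le_self' (fun _ _ => h6) P
        nlinarith
    have hi1 : Integrable fun P => e₀ * F T 0 0 P := hU.const_mul _
    have hi2 : Integrable fun P => (e₀ - e₁) * B.indicator (F T 0 0) P :=
      (hU.indicator hBm).const_mul _
    have hi3 : Integrable fun P => Wᶜ.indicator (F T 0 0) P :=
      hU.indicator hWo.isClosed_compl.measurableSet
    have hi12 : Integrable fun P => e₀ * F T 0 0 P - (e₀ - e₁) * B.indicator (F T 0 0) P :=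
      hi1.sub hi2
    have h4 : ∫ P, F T (ε • k) s P ≤ e₀ * mass F T - (e₀ - e₁) * massOn F T B + massOn F T Wᶜ := by
      refine (integral_mono (h.integrable _ hT hs) (hi12.add hi3) hbound).trans_eq ?_
      simp only [Pi.add_apply]
      rw [integral_add hi12 hi3, integral_sub hi1 hi2, integral_const_mul, integral_const_mul,
        integral_indicator hBm, integral_indicator hWo.isClosed_compl.measurableSet]
      rfl
    have h5 : ∫ P, F T (ε • k) s P ≤ (D + θ) * mass F T := by
      refine h4.trans ?_
      have h8 : (e₀ - e₁) * (w * mass F T) ≤ (e₀ - e₁) * massOn F T B :=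
        mul_le_mul_of_nonneg_left h1 (by linarith)
      rw [hD]
      nlinarith
    have hdpos : 0 < ∫ P, F T 0 s P := lt_of_lt_of_le (mul_pos (by linarith) hm) h3
    rw [div_le_div_iff₀ hdpos (by linarith)]
    have h1θ : 0 < 1 - θ := by linarith
    calc (∫ P, F T (ε • k) s P) * (1 - θ) ≤ (D + θ) * mass F T * (1 - θ) := by gcongr
      _ = (D + θ) * ((1 - θ) * mass F T) := by ring
      _ ≤ (D + θ) * ∫ P, F T 0 s P := by gcongr
  have hl : Tendsto (fun θ : ℝ => G (ε • k) s * (1 - θ)) (𝓝[>] 0) (𝓝 (G (ε • k) s * (1 - 0))) :=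
    (Continuous.tendsto (by fun_prop) 0).mono_left nhdsWithin_le_nhds
  have hrr : Tendsto (fun θ : ℝ => D + θ) (𝓝[>] 0) (𝓝 (D + 0)) :=
    (Continuous.tendsto (by fun_prop) 0).mono_left nhdsWithin_le_nhds
  rw [sub_zero, mul_one] at hl
  rw [add_zero] at hrr
  refine le_of_tendsto_of_tendsto hl hrr ?_
  filter_upwards [Ioo_mem_nhdsGT (zero_lt_one (α := ℝ))] with θ hθ
  exact key θ hθ.1 hθ.2

/-- A heavy minimum that is nondegenerate in all directions forces the mass to be as small as
`T ^ (-d / 2)`, for arbitrarily large `T`. -/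
theorem exists_frequently_mass_le (h : IsHeatDensity E N F) {P₀ : Momentum d}
    (h0 : E P₀ = 0) (hP₀ : IsHeavy F P₀) {c₀ r₀ : ℝ} (hc₀ : 0 < c₀) (hr₀ : 0 < r₀)
    (hE : ∀ P ∈ Metric.ball P₀ r₀, c₀ * ‖P - P₀‖ ^ 2 ≤ E P) :
    ∃ C : ℝ, ∃ᶠ T in atTop, mass F T ≤ C * (√T ^ d)⁻¹ := by
  obtain ⟨r₁, hr₁, c, hc, C, hC, hlow⟩ := h.lower P₀ h0
  set r := min r₀ r₁ with hr
  obtain ⟨w, hw, hfreq⟩ := hP₀ r (lt_min hr₀ hr₁)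
  set g : Momentum d → ℝ := fun P => Real.exp (-(2 * c₀) * ‖P‖ ^ 2) with hg
  have hgi : Integrable g := by
    have := (GaussianFourier.integrable_cexp_neg_mul_sq_norm_add (V := Momentum d)
      (b := (2 * c₀ : ℝ)) (by simpa using hc₀) 0 0).norm
    refine this.congr (ae_of_all _ fun P => ?_)
    simp only [hg, Complex.norm_exp]
    congr 1
    simp [← Complex.ofReal_pow, ← Complex.ofReal_mul]
  refine ⟨w⁻¹ * (C * ∫ P, g P), (hfreq.and_eventually (eventually_gt_atTop 0)).mono ?_⟩
  rintro T ⟨h1, hT⟩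
  have hsT : 0 < √T := Real.sqrt_pos.2 hT
  have hgT : Integrable fun P => C * g (√T • (P - P₀)) :=
    (((integrable_comp_smul_iff volume g hsT.ne').2 hgi).comp_sub_right P₀).const_mul C
  have h2 : massOn F T (Metric.ball P₀ r) ≤ ∫ P, C * g (√T • (P - P₀)) := by
    refine le_trans ?_ (setIntegral_le_integral (s := Metric.ball P₀ r) hgT
      (ae_of_all _ fun P => by positivity))
    refine setIntegral_mono_on_ae (h.integrable 0 hT.le le_rfl).integrableOn hgT.integrableOn
      Metric.isOpen_ball.measurableSet ?_
    filter_upwards [hlow] with P hP hPb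
    have hPr₁ : P ∈ Metric.ball P₀ r₁ := Metric.ball_subset_ball (min_le_right _ _) hPb
    have hPr₀ : P ∈ Metric.ball P₀ r₀ := Metric.ball_subset_ball (min_le_left _ _) hPb
    refine (h.le_N P hT.le).trans ?_
    rw [mul_comm]
    have h3 := (hP hPr₁).1
    have h4 : Real.exp (-(2 * T) * E P) ≤ g (√T • (P - P₀)) := by
      refine Real.exp_le_exp.2 ?_
      rw [norm_smul, mul_pow, Real.norm_of_nonneg hsT.le, Real.sq_sqrt hT.le]
      nlinarith [hE P hPr₀]
    gcongr
  have h5 : ∫ P, C * g (√T • (P - P₀)) = (C * ∫ P, g P) * (√T ^ d)⁻¹ := by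
    rw [integral_const_mul, integral_sub_right_eq_self (fun P => g (√T • P)) P₀,
      Measure.integral_comp_smul_of_nonneg volume g (√T) (hR := hsT.le),
      finrank_euclideanSpace_fin, smul_eq_mul]
    ring
  rw [h5] at h2
  rw [mul_assoc, le_inv_mul_iff₀ hw]
  exact h1.trans h2

/-- Every minimum `P'` of `E` near a given one contributes an amount of order `T ^ (-d / 2)` to
the mass, coming from the momenta at distance less than `T ^ (-1 / 2)` from `P'`. -/
theorem exists_eventually_le_massOn (h : IsHeatDensity E N F) {P₁ : Momentum d}
    (h1 : E P₁ = 0) (A : ℝ) : ∃ c > 0, ∃ r₁ > 0, ∀ r, 0 < r → r ≤ r₁ →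
      ∀ s : Finset (Momentum d), (∀ P' ∈ s, P' ∈ Metric.ball P₁ r ∧
        ∀ᶠ P in 𝓝 P', E P ≤ A * ‖P - P'‖ ^ 2) →
      ∀ᶠ T in atTop, s.card * c * (√T ^ d)⁻¹ ≤ massOn F T (Metric.ball P₁ r) := by
  obtain ⟨r₁, hr₁, c, hc, C, hC, hlow⟩ := h.lower P₁ h1
  set v := volume.real (Metric.ball (0 : Momentum d) 1) with hv
  have hv0 : 0 < v := ENNReal.toReal_pos (Metric.measure_ball_pos _ _ one_pos).ne'
    measure_ball_lt_top.ne
  refine ⟨c * Real.exp (-2 * |A|) * v, by positivity, r₁, hr₁, fun r hr hrr s hs => ?_⟩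
  have hρ1 : ∀ᶠ ρ : ℝ in 𝓝[>] 0, ∀ P' ∈ s, Metric.ball P' ρ ⊆ Metric.ball P₁ r ∩
      {P | E P ≤ A * ‖P - P'‖ ^ 2} := by
    refine (eventually_all_finset s).2 fun P' hP' => ?_
    have : Metric.ball P₁ r ∩ {P | E P ≤ A * ‖P - P'‖ ^ 2} ∈ 𝓝 P' :=
      inter_mem (Metric.isOpen_ball.mem_nhds (hs P' hP').1) (hs P' hP').2
    obtain ⟨ρ₀, hρ₀, hsub⟩ := Metric.mem_nhds_iff.1 this
    filter_upwards [Ioo_mem_nhdsGT hρ₀] with ρ hρ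
    exact (Metric.ball_subset_ball hρ.2.le).trans hsub
  have hρ2 : ∀ᶠ ρ : ℝ in 𝓝[>] 0, ∀ P' ∈ s, ∀ P'' ∈ s, P' ≠ P'' →
      Disjoint (Metric.ball P' ρ) (Metric.ball P'' ρ) := by
    refine (eventually_all_finset s).2 fun P' _ => (eventually_all_finset s).2 fun P'' _ => ?_
    by_cases hne : P' = P''
    · simp [hne]
    have : 0 < dist P' P'' / 2 := half_pos (dist_pos.2 hne)
    filter_upwards [Ioo_mem_nhdsGT this] with ρ hρ _
    exact Metric.ball_disjoint_ball (by linarith [hρ.2])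
  have hlim : Tendsto (fun T : ℝ => (√T)⁻¹) atTop (𝓝[>] 0) :=
    tendsto_inv_atTop_nhdsGT_zero.comp Real.tendsto_sqrt_atTop
  filter_upwards [hlim.eventually hρ1, hlim.eventually hρ2, eventually_gt_atTop 0] with T h2 h3 hT
  have hsT : 0 < √T := Real.sqrt_pos.2 hT
  have hsub : (⋃ P' ∈ s, Metric.ball P' (√T)⁻¹) ⊆ Metric.ball P₁ r :=
    Set.iUnion₂_subset fun P' hP' => (h2 P' hP').trans Set.inter_subset_left
  refine le_trans ?_ (h.massOn_mono hT.le hsub)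
  rw [massOn, integral_biUnion_finset s (fun _ _ => Metric.isOpen_ball.measurableSet)
    (fun P' hP' P'' hP'' hne => h3 P' hP' P'' hP'' hne)
    (fun _ _ => (h.integrable 0 hT.le le_rfl).integrableOn)]
  rw [mul_assoc, ← nsmul_eq_mul]
  refine Finset.card_nsmul_le_sum _ _ _ fun P' hP' => ?_
  have hvol : volume.real (Metric.ball P' (√T)⁻¹) = (√T ^ d)⁻¹ * v := by
    rw [hv, measureReal_def, measureReal_def,
      ← mul_one (√T)⁻¹, Measure.addHaar_ball_mul_of_pos volume P' (inv_pos.2 hsT),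
      ENNReal.toReal_mul, ENNReal.toReal_ofReal (by positivity), finrank_euclideanSpace_fin,
      inv_pow]
  have h4 : ∫ _ in Metric.ball P' (√T)⁻¹, c * Real.exp (-2 * |A|)
      = c * Real.exp (-2 * |A|) * v * (√T ^ d)⁻¹ := by
    rw [setIntegral_const, smul_eq_mul, hvol]; ring
  rw [← h4]
  refine setIntegral_mono_on_ae (integrableOn_const measure_ball_lt_top.ne)
    (h.integrable 0 hT.le le_rfl).integrableOn Metric.isOpen_ball.measurableSet ?_
  filter_upwards [hlow] with P hP hPb
  obtain ⟨hP1, hP2⟩ := h2 P' hP' hPb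
  refine le_trans ?_ ((hP (Metric.ball_subset_ball hrr hP1)).2 T hT.le).1
  have h5 : Real.exp (-2 * |A|) ≤ Real.exp (-(2 * T) * E P) := by
    refine Real.exp_le_exp.2 ?_
    have h6 : ‖P - P'‖ ≤ (√T)⁻¹ := by
      rw [← dist_eq_norm]; exact (Metric.mem_ball.1 hPb).le
    have h7 : T * ‖P - P'‖ ^ 2 ≤ 1 := by
      calc T * ‖P - P'‖ ^ 2 ≤ T * ((√T)⁻¹) ^ 2 := by gcongr
        _ = 1 := by rw [inv_pow, Real.sq_sqrt hT.le, mul_inv_cancel₀ hT.ne']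
    have h8 : T * E P ≤ |A| := by
      have h9 : E P ≤ |A| * ‖P - P'‖ ^ 2 :=
        le_trans hP2 (by gcongr; exact le_abs_self A)
      calc T * E P ≤ T * (|A| * ‖P - P'‖ ^ 2) := by gcongr
        _ = |A| * (T * ‖P - P'‖ ^ 2) := by ring
        _ ≤ |A| * 1 := by gcongr
        _ = |A| := mul_one _
    linarith
  gcongr

end IsHeatDensity

end CLT

/-! ### The densities of a fibered Hamiltonian -/

section Model

variable {d L : ℕ} {𝓗 𝔥 : Type*}
  [NormedAddCommGroup 𝓗] [InnerProductSpace ℂ 𝓗]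
  [NormedAddCommGroup 𝔥] [InnerProductSpace ℂ 𝔥]

/-- If the projection onto `ψ` almost fixes `ψ₀`, the components of a vector along `ψ` and `ψ₀`
have almost the same modulus. -/
theorem norm_inner_sub_le {ψ ψ₀ : 𝔥} (hψ : ‖ψ‖ = 1) (hψ₀ : ‖ψ₀‖ = 1) {η : ℝ}
    (h : ‖⟪ψ, ψ₀⟫_ℂ • ψ - ψ₀‖ ≤ η) (u : 𝔥) : |‖⟪ψ, u⟫_ℂ‖ - ‖⟪ψ₀, u⟫_ℂ‖| ≤ 2 * η * ‖u‖ := by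
  set a := ⟪ψ, ψ₀⟫_ℂ with ha
  have ha1 : ‖a • ψ‖ = ‖a‖ := by rw [norm_smul, hψ, mul_one]
  have ha2 : ‖a‖ ≤ 1 := by simpa [hψ, hψ₀] using norm_inner_le_norm (𝕜 := ℂ) ψ ψ₀
  have ha3 : 1 - η ≤ ‖a‖ := by
    have := norm_sub_norm_le ψ₀ (a • ψ)
    rw [norm_sub_rev, ha1, hψ₀] at this
    linarith
  have h1 : |‖⟪a • ψ, u⟫_ℂ‖ - ‖⟪ψ₀, u⟫_ℂ‖| ≤ η * ‖u‖ := by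
    refine (abs_norm_sub_norm_le _ _).trans ?_
    rw [← inner_sub_left]
    exact (norm_inner_le_norm _ _).trans (by gcongr)
  have h2 : ‖⟪a • ψ, u⟫_ℂ‖ = ‖a‖ * ‖⟪ψ, u⟫_ℂ‖ := by
    rw [inner_smul_left, norm_mul, RCLike.norm_conj]
  have h3 : ‖⟪ψ, u⟫_ℂ‖ ≤ ‖u‖ := by simpa [hψ] using norm_inner_le_norm (𝕜 := ℂ) ψ u
  rw [h2] at h1
  rw [abs_le] at h1 ⊢
  have h4 := norm_nonneg (⟪ψ, u⟫_ℂ)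
  have h5 : (1 - ‖a‖) * ‖⟪ψ, u⟫_ℂ‖ ≤ η * ‖u‖ := by
    have : 1 - ‖a‖ ≤ η := by linarith
    nlinarith
  have h6 : 0 ≤ (1 - ‖a‖) * ‖⟪ψ, u⟫_ℂ‖ := mul_nonneg (by linarith) h4
  constructor <;> nlinarith

/-- The integrand of the unnormalized characteristic function. -/
def density (V : 𝓗 ≃ₗᵢ[ℂ] Lp 𝔥 2 (volume : Measure (Momentum d)))
    (b : Momentum d → 𝔥 →L[ℂ] 𝔥) [CompleteSpace 𝔥] (φ : 𝓗) (T : ℝ) (k : Momentum d) (t : ℝ)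
    (P : Momentum d) : ℝ :=
  (⟪heatOp T (b P) (V φ P), heatOp t (b (P + k)) (heatOp T (b P) (V φ P))⟫_ℂ).re

variable {V : 𝓗 ≃ₗᵢ[ℂ] Lp 𝔥 2 (volume : Measure (Momentum d))}
  {H : Momentum d → 𝔥 →ₗ.[ℂ] 𝔥} {Er : ℝ → ℝ}
  {Q : Fin (L + 1) → ℝ} {Δ : Fin (L + 1) → Set ℝ} {n : Fin (L + 1) → ℕ} {ψ : Momentum d → 𝔥}
  {φ : 𝓗} {σ : ℝ}

theorem density_zero [CompleteSpace 𝔥] (b : Momentum d → 𝔥 →L[ℂ] 𝔥) (T : ℝ) (P : Momentum d) :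
    density V b φ T 0 0 P = ‖heatOp T (b P) (V φ P)‖ ^ 2 := by
  rw [density, heatOp_zero]
  exact inner_self_eq_norm_sq (𝕜 := ℂ) _

theorem exists_norm_eq (hd : 0 < d) {x : ℝ} (hx : 0 ≤ x) : ∃ P : Momentum d, ‖P‖ = x :=
  ⟨EuclideanSpace.single ⟨0, hd⟩ x, by simp [abs_of_nonneg hx]⟩

variable [CompleteSpace 𝔥]

namespace StandingAssumptions

theorem isInvOneAdd (hH : StandingAssumptions H Er Q Δ n ψ) (P : Momentum d) :
    IsInvOneAdd (H P) (resolvent (H P) (-1)) :=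
  isInvOneAdd_resolvent (hH.selfAdjoint P) (hH.positive P)

theorem continuous_resolvent (hH : StandingAssumptions H Er Q Δ n ψ) :
    Continuous fun P => resolvent (H P) (-1) :=
  continuous_iff_continuousAt.2 fun P => (hH.analytic P (-1)
    (neg_one_mem_resolventSet (hH.selfAdjoint P) (hH.positive P))).2.continuousAt

theorem Q_nonneg' (hH : StandingAssumptions H Er Q Δ n ψ) (ℓ : Fin (L + 1)) : 0 ≤ Q ℓ :=
  hH.Q_nonneg.trans (hH.Q_strictMono.monotone (Fin.zero_le ℓ))

theorem shell_mem_nhds (hH : StandingAssumptions H Er Q Δ n ψ) {ℓ : Fin (L + 1)} {P : Momentum d}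
    (hP : ‖P‖ = Q ℓ) : shell d (Δ ℓ) ∈ 𝓝 P :=
  continuous_norm.continuousAt.preimage_mem_nhds (by rw [hP]; exact hH.Δ_mem_nhds ℓ)

theorem nontrivial (hH : StandingAssumptions H Er Q Δ n ψ) (hd : 0 < d) : Nontrivial 𝔥 := by
  obtain ⟨P, hP⟩ := exists_norm_eq hd hH.Q_nonneg
  have := hH.ψ_norm 0 P (mem_of_mem_nhds (hH.shell_mem_nhds hP))
  exact ⟨ψ P, 0, fun h => by simp [h] at this⟩

theorem continuous_infSpec (hH : StandingAssumptions H Er Q Δ n ψ) (hd : 0 < d) :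
    Continuous fun P => infSpec (H P) := by
  have := hH.nontrivial hd
  have h1 : (fun P => infSpec (H P)) = fun P => ‖resolvent (H P) (-1)‖⁻¹ - 1 :=
    funext fun P => (hH.isInvOneAdd P).infSpec_eq
  rw [h1]
  exact (hH.continuous_resolvent.norm.inv₀ fun P => (hH.isInvOneAdd P).norm_pos.ne').sub
    continuous_const

theorem resolvent_ψ (hH : StandingAssumptions H Er Q Δ n ψ) {ℓ : Fin (L + 1)} {P : Momentum d}
    (hP : P ∈ shell d (Δ ℓ)) :
    resolvent (H P) (-1) (ψ P) = (1 + infSpec (H P))⁻¹ • ψ P :=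
  (hH.isInvOneAdd P).apply_eigenvector (hH.isInvOneAdd P).infSpec_nonneg
    ((hH.ψ_simple ℓ P hP (ψ P)).2 ⟨1, (one_smul ℂ _).symm⟩)

theorem density_lower (hH : StandingAssumptions H Er Q Δ n ψ) (hφ : IsAdmissible V Q Δ ψ φ)
    (hd : 0 < d) {P₀ : Momentum d} {ℓ : Fin (L + 1)} (hP₀ : ‖P₀‖ = Q ℓ) :
    ∃ r > 0, ∃ c > 0, ∃ C > 0, ∀ᵐ P, P ∈ Metric.ball P₀ r → ‖V φ P‖ ^ 2 ≤ C ∧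
      ∀ T, 0 ≤ T → c * Real.exp (-(2 * T) * infSpec (H P)) ≤
          density V (fun P => resolvent (H P) (-1)) φ T 0 0 P ∧
        ∀ t, 0 ≤ t → ∀ k, ‖k‖ < r → c * Real.exp (-t * infSpec (H (P + k))) *
          density V (fun P => resolvent (H P) (-1)) φ T 0 0 P ≤
            density V (fun P => resolvent (H P) (-1)) φ T k t P := by
  have := hH.nontrivial hd
  obtain ⟨g, hg, hg0, hgφ⟩ := hφ.overlap ℓ
  obtain ⟨C', hC'⟩ := hφ.bounded ℓ
  set C := max C' 1 with hC
  have hC0 : 0 < C := lt_of_lt_of_le one_pos (le_max_right _ _)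
  have hsh := hH.shell_mem_nhds hP₀
  set c := |g P₀| / 2 with hc
  have hc0 : 0 < c := half_pos (abs_pos.2 (hg0 P₀ hP₀))
  -- `c / C` bounds the component of `u` along `ψ P`, relative to `‖u‖`, from below; changing `ψ P`
  -- to `ψ P₀` and then to `ψ (P + k)` changes it by at most `4 η`, half of `c / C`
  set η := c / (8 * C) with hη
  have hη0 : 0 < η := by positivity
  have hψ₀ := hH.ψ_norm ℓ P₀ (mem_of_mem_nhds hsh)
  have e1 : ∀ᶠ P in 𝓝 P₀, c < |g P| :=
    (hg.continuousAt hsh).abs.eventually_const_lt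
      (by rw [hc]; exact half_lt_self (abs_pos.2 (hg0 P₀ hP₀)))
  have e2 : ∀ᶠ P in 𝓝 P₀, ‖⟪ψ P, ψ P₀⟫_ℂ • ψ P - ψ P₀‖ < η := by
    have h1 := ((hH.ψ_continuous ℓ (ψ P₀)).continuousAt hsh).sub_const (ψ P₀)
    have h2 := h1.norm
    have h3 : ‖⟪ψ P₀, ψ P₀⟫_ℂ • ψ P₀ - ψ P₀‖ < η := by
      rw [inner_self_eq_norm_sq_to_K, hψ₀]
      simpa using hη0
    exact h2.eventually_lt_const h3
  obtain ⟨R, hR, hball⟩ := Metric.mem_nhds_iff.1 (inter_mem hsh (inter_mem e1 e2))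
  refine ⟨R / 2, half_pos hR, min (c ^ 2) ((c / (2 * C)) ^ 2), by positivity, C ^ 2,
    by positivity, ?_⟩
  filter_upwards [hgφ, hC'] with P hP1 hP2 hPb
  have hPR : P ∈ Metric.ball P₀ R := Metric.ball_subset_ball (by linarith) hPb
  obtain ⟨hPs, hPg, hPψ⟩ := hball hPR
  have hPg : c < |g P| := hPg
  have hPψ : ‖⟪ψ P, ψ P₀⟫_ℂ • ψ P - ψ P₀‖ < η := hPψ
  have hφC : ‖V φ P‖ ≤ C := (hP2 hPs).trans (le_max_left _ _)
  refine ⟨by gcongr, fun T hT => ?_⟩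
  rw [density_zero]
  have hB := hH.isInvOneAdd P
  have hE := hB.infSpec_nonneg
  set E := infSpec (H P) with hEdef
  set u := heatOp T (resolvent (H P) (-1)) (V φ P) with hu
  have hψP := hH.ψ_norm ℓ P hPs
  have hexp : Real.exp (-(2 * T) * E) = Real.exp (-T * E) ^ 2 := by
    rw [← Real.exp_nat_mul]; push_cast; ring_nf
  have hψu : ‖⟪ψ P, u⟫_ℂ‖ = Real.exp (-T * E) * |g P| := by
    rw [hu, inner_heatOp, hB.isPosContraction.heatOp_eigenvector hE (hH.resolvent_ψ hPs) hT,
      ← Complex.coe_smul, inner_smul_left, norm_mul, RCLike.norm_conj, Complex.norm_real,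
      Real.norm_of_nonneg (Real.exp_nonneg _), norm_inner_symm, ← hP1 hPs, abs_norm]
  have hu1 : Real.exp (-T * E) * c ≤ ‖⟪ψ P, u⟫_ℂ‖ := by rw [hψu]; gcongr
  have hu2 : ‖⟪ψ P, u⟫_ℂ‖ ≤ ‖u‖ := by simpa [hψP] using norm_inner_le_norm (𝕜 := ℂ) (ψ P) u
  have hu3 : ‖u‖ ≤ Real.exp (-T * E) * C :=
    ((heatOp T _).le_of_opNorm_le (hB.isPosContraction.norm_heatOp_le hT hE hB.norm_eq.le) _).trans
      (by gcongr)
  refine ⟨?_, fun t ht k hk => ?_⟩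
  · rw [hexp]
    calc min (c ^ 2) ((c / (2 * C)) ^ 2) * Real.exp (-T * E) ^ 2
        ≤ c ^ 2 * Real.exp (-T * E) ^ 2 := by gcongr; exact min_le_left _ _
      _ = (Real.exp (-T * E) * c) ^ 2 := by ring
      _ ≤ ‖u‖ ^ 2 := by gcongr; exact hu1.trans hu2
  · have hPk : P + k ∈ Metric.ball P₀ R := by
      rw [Metric.mem_ball, dist_eq_norm] at hPb ⊢
      have : P + k - P₀ = (P - P₀) + k := by abel
      rw [this]
      exact (norm_add_le _ _).trans_lt (by linarith)
    obtain ⟨hks, -, hkψ⟩ := hball hPk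
    have hkψ : ‖⟪ψ (P + k), ψ P₀⟫_ℂ • ψ (P + k) - ψ P₀‖ < η := hkψ
    have hψk := hH.ψ_norm ℓ _ hks
    have hBk := hH.isInvOneAdd (P + k)
    have h1 := (abs_le.1 (norm_inner_sub_le hψP hψ₀ hPψ.le u)).2
    have h2 := (abs_le.1 (norm_inner_sub_le hψk hψ₀ hkψ.le u)).1
    have h3 : c / C * ‖u‖ ≤ ‖⟪ψ P, u⟫_ℂ‖ := by
      rw [div_mul_eq_mul_div, div_le_iff₀ hC0]
      calc c * ‖u‖ ≤ c * (Real.exp (-T * E) * C) := by gcongr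
        _ = Real.exp (-T * E) * c * C := by ring
        _ ≤ _ := by gcongr
    have h4 : c / (2 * C) * ‖u‖ ≤ ‖⟪ψ (P + k), u⟫_ℂ‖ := by
      have e3 : c / (2 * C) = c / C - 4 * η := by rw [hη]; field_simp; norm_num
      rw [e3, sub_mul]
      linarith
    have h5 := hBk.isPosContraction.le_re_inner_heatOp hBk.infSpec_nonneg hψk
      (hH.resolvent_ψ hks) ht u
    refine le_trans ?_ h5
    calc min (c ^ 2) ((c / (2 * C)) ^ 2) * Real.exp (-t * infSpec (H (P + k))) * ‖u‖ ^ 2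
        ≤ (c / (2 * C)) ^ 2 * Real.exp (-t * infSpec (H (P + k))) * ‖u‖ ^ 2 := by
          gcongr; exact min_le_right _ _
      _ = Real.exp (-t * infSpec (H (P + k))) * (c / (2 * C) * ‖u‖) ^ 2 := by ring
      _ ≤ _ := by gcongr

variable [CompleteSpace 𝓗]

theorem isHeatDensity (hH : StandingAssumptions H Er Q Δ n ψ) (hφ : IsAdmissible V Q Δ ψ φ)
    (hd : 0 < d) : IsHeatDensity (fun P => infSpec (H P)) (fun P => ‖V φ P‖ ^ 2)
      (density V (fun P => resolvent (H P) (-1)) φ) where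
  continuous := hH.continuous_infSpec hd
  energy_nonneg P := (hH.isInvOneAdd P).infSpec_nonneg
  coercive := hH.pos_at_infinity
  exists_zero := by
    obtain ⟨P, hP⟩ := exists_norm_eq hd hH.Q_nonneg
    exact ⟨P, (hH.minima P).2 ⟨0, hP⟩⟩
  integrable_N := (Lp.memLp (V φ)).integrable_norm_pow two_ne_zero
  N_nonneg P := by positivity
  integrable k hT ht :=
    (charFunTilde_eq_integral hH.continuous_resolvent hH.isInvOneAdd φ hT ht k).1
  nonneg T k t P := re_inner_heatOp_nonneg _ _ _
  le {T t} k P hT ht := by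
    have := hH.nontrivial hd
    have hB := hH.isInvOneAdd (P + k)
    rw [density_zero]
    exact hB.isPosContraction.re_inner_heatOp_le ht hB.infSpec_nonneg hB.norm_eq.le _
  le_N {T} P hT := by
    have := hH.nontrivial hd
    have hB := hH.isInvOneAdd P
    have h1 := (heatOp T _).le_of_opNorm_le
      (hB.isPosContraction.norm_heatOp_le hT hB.infSpec_nonneg hB.norm_eq.le) (V φ P)
    have hexp : Real.exp (-(2 * T) * infSpec (H P)) = Real.exp (-T * infSpec (H P)) ^ 2 := by
      rw [← Real.exp_nat_mul]; push_cast; ring_nf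
    rw [density_zero, hexp, ← mul_pow]
    gcongr
  ge {T t η} P hT ht hη := by
    have := (hH.isInvOneAdd P).isPosContraction.re_inner_heatOp_ge hT ht hη (V φ P)
    rw [density_zero, density, add_zero]
    exact this
  lower P₀ hP₀ := by
    obtain ⟨ℓ, hℓ⟩ := (hH.minima P₀).1 hP₀
    exact hH.density_lower hφ hd hℓ

theorem densityCLT (hH : StandingAssumptions H Er Q Δ n ψ) (hCLT : TwoSidedCLT V H φ σ) :
    DensityCLT (density V (fun P => resolvent (H P) (-1)) φ) σ := by
  obtain ⟨G, hG1, hG2⟩ := hCLT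
  refine ⟨fun k t => (G k t).re, fun k t ht => ?_, fun k t ht => ?_⟩
  · refine ((Complex.continuous_re.tendsto _).comp (hG1 k t ht)).congr' ?_
    filter_upwards [eventually_ge_atTop 0] with T hT
    have h := fun k =>
      (charFunTilde_eq_integral (V := V) hH.continuous_resolvent hH.isInvOneAdd φ hT ht k).2
    rw [Function.comp_apply, charFun, h, h, ← Complex.ofReal_div, Complex.ofReal_re]
    rfl
  · have h := (Complex.continuous_re.tendsto _).comp (hG2 k t ht)
    rw [Complex.ofReal_re] at h
    exact h.mono_left (nhdsWithin_mono _ fun ε hε => ne_of_gt hε)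

end StandingAssumptions

end Model

/-! ### The energy near its minima -/

section Energy

variable {d L : ℕ} {𝔥 : Type*} [NormedAddCommGroup 𝔥] [InnerProductSpace ℂ 𝔥] [CompleteSpace 𝔥]
  {H : Momentum d → 𝔥 →ₗ.[ℂ] 𝔥} {Er : ℝ → ℝ}
  {Q : Fin (L + 1) → ℝ} {Δ : Fin (L + 1) → Set ℝ} {n : Fin (L + 1) → ℕ} {ψ : Momentum d → 𝔥}

/-- The second-order Taylor expansion at an interior minimum with value `0`. -/
theorem isLittleO_of_isLocalMin {g : ℝ → ℝ} {x₀ : ℝ} (hg : AnalyticAt ℝ g x₀) (h0 : g x₀ = 0)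
    (hmin : IsLocalMin g x₀) :
    (fun x => g x - iteratedDeriv 2 g x₀ / 2 * (x - x₀) ^ 2) =o[𝓝 x₀] fun x => (x - x₀) ^ 2 := by
  obtain ⟨ρ, hρ, hball⟩ := Metric.mem_nhds_iff.1 hg.eventually_analyticAt
  have hx₀ : x₀ ∈ Metric.ball x₀ ρ := Metric.mem_ball_self hρ
  have hcd : ContDiffOn ℝ (2 : ℕ) g (Metric.ball x₀ ρ) := fun x hx =>
    (AnalyticAt.contDiffAt (hball hx)).contDiffWithinAt
  have h1 := taylor_isLittleO (convex_ball x₀ ρ) hx₀ hcd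
  rw [Metric.isOpen_ball.nhdsWithin_eq hx₀] at h1
  refine h1.congr (fun x => ?_) fun x => rfl
  rw [taylorWithinEval_succ, taylorWithinEval_succ, taylor_within_zero_eval,
    iteratedDerivWithin_of_isOpen Metric.isOpen_ball hx₀,
    iteratedDerivWithin_of_isOpen Metric.isOpen_ball hx₀, h0]
  norm_num [hmin.deriv_eq_zero]
  ring

namespace StandingAssumptions

theorem infSpec_nonneg (hH : StandingAssumptions H Er Q Δ n ψ) (P : Momentum d) :
    0 ≤ infSpec (H P) := (hH.isInvOneAdd P).infSpec_nonneg

/-- Near the minimum `Q ℓ` the energy is quadratic up to an error of higher order, the coefficient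
being half the (at `Q ℓ = 0`, one-sided) second derivative. The value of the second derivative is
computed along a line through the origin, on which the energy is an analytic function. -/
theorem exists_energy_near (hH : StandingAssumptions H Er Q Δ n ψ) (hd : 0 < d)
    (ℓ : Fin (L + 1)) {η : ℝ} (hη : 0 < η) : ∃ ρ > 0, ∀ P : Momentum d, |‖P‖ - Q ℓ| < ρ →
      |infSpec (H P) - iteratedDerivWithin 2 Er (Set.Ici 0) (Q ℓ) / 2 * (‖P‖ - Q ℓ) ^ 2| ≤
        η * (‖P‖ - Q ℓ) ^ 2 := by
  obtain ⟨v, hv⟩ := exists_norm_eq hd zero_le_one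
  set g : ℝ → ℝ := fun x => infSpec (H (x • v)) with hg
  have hgE : Set.EqOn Er g (Set.Ici 0) := fun x hx => by
    rw [hg]
    simp only
    rw [hH.radial, norm_smul, hv, mul_one, Real.norm_of_nonneg hx]
  have hQ := hH.Q_nonneg' ℓ
  have hQv : ‖Q ℓ • v‖ = Q ℓ := by rw [norm_smul, hv, mul_one, Real.norm_of_nonneg hQ]
  have hga : AnalyticAt ℝ g (Q ℓ) := by
    have h1 := hH.energy_analytic ℓ (Q ℓ • v) (mem_of_mem_nhds (hH.shell_mem_nhds hQv))
    have h2 : AnalyticAt ℝ (fun x : ℝ => x • v) (Q ℓ) := analyticAt_id.smul analyticAt_const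
    exact AnalyticAt.fun_comp (g := fun P => infSpec (H P)) h1 h2
  have hg0 : g (Q ℓ) = 0 := (hH.minima _).2 ⟨ℓ, hQv⟩
  have hmin : IsLocalMin g (Q ℓ) := Eventually.of_forall fun x => by
    rw [hg0]; exact hH.infSpec_nonneg _
  have hder : iteratedDerivWithin 2 Er (Set.Ici 0) (Q ℓ) = iteratedDeriv 2 g (Q ℓ) := by
    rw [iteratedDerivWithin_congr hgE hQ]
    exact iteratedDerivWithin_eq_iteratedDeriv (uniqueDiffOn_Ici 0) hga.contDiffAt hQ
  have h1 := (isLittleO_of_isLocalMin hga hg0 hmin).def hη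
  obtain ⟨ρ, hρ, hball⟩ := Metric.mem_nhds_iff.1 h1
  refine ⟨ρ, hρ, fun P hP => ?_⟩
  have h2 : ‖g ‖P‖ - iteratedDeriv 2 g (Q ℓ) / 2 * (‖P‖ - Q ℓ) ^ 2‖ ≤ η * ‖(‖P‖ - Q ℓ) ^ 2‖ :=
    hball (by rw [Metric.mem_ball, Real.dist_eq]; exact hP)
  rw [← hgE (norm_nonneg P), ← hH.radial, ← hder, Real.norm_eq_abs,
    Real.norm_of_nonneg (by positivity)] at h2
  exact h2

theorem second_deriv_nonneg (hH : StandingAssumptions H Er Q Δ n ψ) (hd : 0 < d)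
    (ℓ : Fin (L + 1)) : 0 ≤ iteratedDerivWithin 2 Er (Set.Ici 0) (Q ℓ) := by
  refine le_of_forall_pos_le_add fun η hη => ?_
  obtain ⟨ρ, hρ, hE⟩ := hH.exists_energy_near hd ℓ (half_pos hη)
  obtain ⟨P, hP⟩ := exists_norm_eq hd (x := Q ℓ + ρ / 2)
    (add_nonneg (hH.Q_nonneg' ℓ) (by positivity))
  have h1 : ‖P‖ - Q ℓ = ρ / 2 := by rw [hP]; ring
  have h2 := hE P (by rw [h1, abs_of_pos (by positivity)]; linarith)
  rw [h1] at h2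
  have h3 := (abs_le.1 h2).2
  have h4 := hH.infSpec_nonneg P
  have h5 : 0 < (ρ / 2) ^ 2 := by positivity
  by_contra! hlt
  nlinarith

theorem exists_isolated (hH : StandingAssumptions H Er Q Δ n ψ) {P₁ : Momentum d}
    {ℓ : Fin (L + 1)} (hP₁ : ‖P₁‖ = Q ℓ) :
    ∃ r > 0, ∀ P ∈ Metric.closedBall P₁ r, infSpec (H P) = 0 → ‖P‖ = Q ℓ := by
  have h1 : ∀ᶠ P in 𝓝 P₁, ∀ ℓ', ‖P‖ = Q ℓ' → ℓ' = ℓ := by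
    refine eventually_all.2 fun ℓ' => ?_
    by_cases hℓ : ℓ' = ℓ
    · exact Eventually.of_forall fun _ _ => hℓ
    have hne : ‖P₁‖ ≠ Q ℓ' := by
      rw [hP₁]; exact fun h => hℓ (hH.Q_strictMono.injective h).symm
    filter_upwards [continuous_norm.continuousAt.eventually_ne hne] with P hP h
    exact absurd h hP
  obtain ⟨r, hr, hball⟩ := Metric.nhds_basis_closedBall.mem_iff.1 h1
  refine ⟨r, hr, fun P hP hE => ?_⟩
  obtain ⟨ℓ', hℓ'⟩ := (hH.minima P).1 hE
  rw [hℓ', hball hP ℓ' hℓ']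

/-! ### Identification of the diffusion constant -/

variable {N : Momentum d → ℝ} {F : ℝ → Momentum d → ℝ → Momentum d → ℝ} {σ : ℝ}

theorem le_second_deriv_of_isHeavy (hH : StandingAssumptions H Er Q Δ n ψ) (hd : 0 < d)
    (h : IsHeatDensity (fun P => infSpec (H P)) N F) (hF : DensityCLT F σ) {P₀ : Momentum d}
    {ℓ : Fin (L + 1)} (hP₀ : ‖P₀‖ = Q ℓ) (hh : IsHeavy F P₀) :
    σ ^ 2 ≤ iteratedDerivWithin 2 Er (Set.Ici 0) (Q ℓ) := by
  set e := iteratedDerivWithin 2 Er (Set.Ici 0) (Q ℓ) with he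
  have he0 : 0 ≤ e := hH.second_deriv_nonneg hd ℓ
  refine le_of_forall_pos_le_add fun η hη => ?_
  obtain ⟨ρ, hρ, hE⟩ := hH.exists_energy_near hd ℓ (η := η / 4) (by positivity)
  obtain ⟨r, hr, hiso⟩ := hH.exists_isolated hP₀
  obtain ⟨v, hv⟩ := exists_norm_eq hd zero_le_one
  have := h.le_of_isHeavy hF ((hH.minima P₀).2 ⟨ℓ, hP₀⟩) hh (k := v) (κ := e / 2 + η / 2) hr ?_
  · rw [hv] at this; linarith
  filter_upwards [Ioo_mem_nhdsGT hρ] with ε hε P hP hP0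
  have hPQ := hiso P hP hP0
  have h1 : |‖P + ε • v‖ - Q ℓ| ≤ ε := by
    rw [← hPQ]
    refine (abs_norm_sub_norm_le _ _).trans ?_
    rw [add_sub_cancel_left, norm_smul, hv, mul_one, Real.norm_of_nonneg hε.1.le]
  have h2 := (abs_le.1 (hE _ (h1.trans_lt hε.2))).2
  rw [← he] at h2
  have h3 : (‖P + ε • v‖ - Q ℓ) ^ 2 ≤ ε ^ 2 := sq_le_sq' (abs_le.1 h1).1 (abs_le.1 h1).2
  have h4 : 0 < ε ^ 2 := pow_pos hε.1 2
  nlinarith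

/-- To second order, the energy does not increase in the directions tangential to a sphere of minima
of positive radius, so at a heavy point of the sphere the diffusion constant in such a direction
would be `0`. -/
theorem not_isHeavy_of_pos (hH : StandingAssumptions H Er Q Δ n ψ) (hd : 2 ≤ d)
    (h : IsHeatDensity (fun P => infSpec (H P)) N F) (hσ : 0 < σ) (hF : DensityCLT F σ)
    {P₀ : Momentum d} {ℓ : Fin (L + 1)} (hP₀ : ‖P₀‖ = Q ℓ) (hQ : 0 < Q ℓ) : ¬ IsHeavy F P₀ := by
  intro hh
  have hd0 : 0 < d := by omega
  set e := iteratedDerivWithin 2 Er (Set.Ici 0) (Q ℓ) with he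
  have he0 : 0 ≤ e := hH.second_deriv_nonneg hd0 ℓ
  obtain ⟨k, hk, hkP⟩ : ∃ k : Momentum d, ‖k‖ = 1 ∧ ⟪P₀, k⟫_ℝ = 0 := by
    have hlt : Module.finrank ℝ (Submodule.span ℝ {P₀}) < Module.finrank ℝ (Momentum d) := by
      have hP₀0 : P₀ ≠ 0 := by
        rintro rfl; rw [norm_zero] at hP₀; exact hQ.ne hP₀
      rw [finrank_euclideanSpace_fin, finrank_span_singleton hP₀0]
      omega
    have hne : (Submodule.span ℝ {P₀})ᗮ ≠ ⊥ := by
      intro hbot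
      rw [Submodule.orthogonal_eq_bot_iff] at hbot
      rw [hbot, finrank_top] at hlt
      exact lt_irrefl _ hlt
    obtain ⟨k, hk, hk0⟩ := Submodule.exists_mem_ne_zero_of_ne_bot hne
    refine ⟨‖k‖⁻¹ • k, norm_smul_inv_norm hk0, ?_⟩
    rw [inner_smul_right, Submodule.mem_orthogonal_singleton_iff_inner_right.1 hk, mul_zero]
  obtain ⟨ρ, hρ, hE⟩ := hH.exists_energy_near hd0 ℓ one_pos
  obtain ⟨r, hr, hiso⟩ := hH.exists_isolated hP₀
  set M := e / 2 + 1 with hM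
  -- a point at distance at most `r₀` from `P₀` moves by `3 r₀ ε / Q` in the radial direction
  set r₀ := min r (Q ℓ * σ / (7 * M)) with hr₀
  have hr₀0 : 0 < r₀ := lt_min hr (by positivity)
  have hcon := h.le_of_isHeavy hF ((hH.minima P₀).2 ⟨ℓ, hP₀⟩) hh (k := k) (κ := σ ^ 2 / 4) hr₀0 ?_
  · rw [hk] at hcon; nlinarith
  have hρ' : 0 < ρ * Q ℓ / (3 * r₀) := by positivity
  filter_upwards [Ioo_mem_nhdsGT hr₀0, Ioo_mem_nhdsGT hρ'] with ε hε hε' P hP hP0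
  have hPQ := hiso P (Metric.closedBall_subset_closedBall (min_le_left _ _) hP) hP0
  have hε0 := hε.1
  have h1 : |⟪P, k⟫_ℝ| ≤ r₀ := by
    have : ⟪P, k⟫_ℝ = ⟪P - P₀, k⟫_ℝ := by rw [inner_sub_left, hkP, sub_zero]
    rw [this]
    refine (abs_real_inner_le_norm _ _).trans ?_
    rw [hk, mul_one, ← dist_eq_norm]
    exact hP
  have h2 : ‖P + ε • k‖ ^ 2 = Q ℓ ^ 2 + 2 * ε * ⟪P, k⟫_ℝ + ε ^ 2 := by
    rw [norm_add_sq_real, hPQ, inner_smul_right, norm_smul, hk, Real.norm_of_nonneg hε0.le]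
    ring
  have h3 : |‖P + ε • k‖ - Q ℓ| * Q ℓ ≤ 3 * r₀ * ε := by
    have e1 : |‖P + ε • k‖ - Q ℓ| * (‖P + ε • k‖ + Q ℓ) = |2 * ε * ⟪P, k⟫_ℝ + ε ^ 2| := by
      rw [← abs_of_nonneg (by positivity : 0 ≤ ‖P + ε • k‖ + Q ℓ), ← abs_mul]
      congr 1
      linear_combination h2
    have e2 : |2 * ε * ⟪P, k⟫_ℝ + ε ^ 2| ≤ 2 * ε * r₀ + ε ^ 2 := by
      refine (abs_add_le _ _).trans ?_
      rw [abs_mul, abs_of_pos (by positivity : 0 < 2 * ε), abs_of_pos (by positivity : 0 < ε ^ 2)]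
      gcongr
    have e3 : ε ^ 2 ≤ r₀ * ε := by rw [pow_two]; exact mul_le_mul_of_nonneg_right hε.2.le hε0.le
    have e4 : 0 ≤ |‖P + ε • k‖ - Q ℓ| * ‖P + ε • k‖ := by positivity
    nlinarith
  have h4 : |‖P + ε • k‖ - Q ℓ| ≤ 3 * r₀ * ε / Q ℓ := (le_div_iff₀ hQ).2 h3
  have h5 : 3 * r₀ * ε / Q ℓ < ρ := by
    rw [div_lt_iff₀ hQ]
    have := (lt_div_iff₀ (by positivity)).1 hε'.2
    linarith
  have h6 := (abs_le.1 (hE _ (h4.trans_lt h5))).2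
  have h7 : (‖P + ε • k‖ - Q ℓ) ^ 2 ≤ (3 * r₀ * ε / Q ℓ) ^ 2 :=
    sq_le_sq' (abs_le.1 h4).1 (abs_le.1 h4).2
  have hM1 : 1 ≤ M := by rw [hM]; linarith
  have h8 : infSpec (H (P + ε • k)) ≤ M * (‖P + ε • k‖ - Q ℓ) ^ 2 := by
    rw [hM]; rw [← he] at h6; linarith
  have h9 : r₀ ≤ Q ℓ * σ / (7 * M) := min_le_right _ _
  calc infSpec (H (P + ε • k)) ≤ M * (3 * (Q ℓ * σ / (7 * M)) * ε / Q ℓ) ^ 2 := by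
        refine h8.trans (mul_le_mul_of_nonneg_left (h7.trans ?_) (by positivity))
        gcongr
    _ = 9 / (49 * M) * σ ^ 2 * ε ^ 2 := by field_simp; ring
    _ ≤ 9 / 49 * σ ^ 2 * ε ^ 2 := by
        gcongr
        linarith
    _ < σ ^ 2 / 4 * ε ^ 2 := by
        have : 0 < σ ^ 2 * ε ^ 2 := by positivity
        nlinarith

/-- At a heavy minimum near which the distance to the sphere is the distance to the point (so the
minimum is nondegenerate in all directions), the mass is as small as `T ^ (-d / 2)`. -/
theorem exists_frequently_mass_le (hH : StandingAssumptions H Er Q Δ n ψ) (hd : 0 < d)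
    (h : IsHeatDensity (fun P => infSpec (H P)) N F) (hσ : 0 < σ) (hF : DensityCLT F σ)
    {P₀ : Momentum d} {ℓ : Fin (L + 1)} (hP₀ : ‖P₀‖ = Q ℓ) (hh : IsHeavy F P₀) {ρ : ℝ}
    (hρ : 0 < ρ) (hR : ∀ P, ‖P - P₀‖ < ρ → |‖P‖ - ‖P₀‖| = ‖P - P₀‖) :
    ∃ C : ℝ, ∃ᶠ T in atTop, mass F T ≤ C * (√T ^ d)⁻¹ := by
  have he := hH.le_second_deriv_of_isHeavy hd h hF hP₀ hh
  set e := iteratedDerivWithin 2 Er (Set.Ici 0) (Q ℓ) with hedef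
  have he0 : 0 < e := lt_of_lt_of_le (by positivity) he
  obtain ⟨ρ', hρ', hE⟩ := hH.exists_energy_near hd ℓ (η := e / 4) (by positivity)
  refine h.exists_frequently_mass_le ((hH.minima P₀).2 ⟨ℓ, hP₀⟩) hh (c₀ := e / 4)
    (r₀ := min ρ ρ') (by positivity) (lt_min hρ hρ') fun P hP => ?_
  rw [Metric.mem_ball, dist_eq_norm, lt_min_iff] at hP
  have h1 := hR P hP.1
  rw [hP₀] at h1
  have h2 := (abs_le.1 (hE P (h1 ▸ hP.2))).1
  rw [← hedef, ← sq_abs, h1] at h2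
  linarith

theorem eventually_energy_le (hH : StandingAssumptions H Er Q Δ n ψ) (hd : 0 < d)
    {P' : Momentum d} {ℓ : Fin (L + 1)} (hP' : ‖P'‖ = Q ℓ) :
    ∀ᶠ P in 𝓝 P', infSpec (H P) ≤
      (iteratedDerivWithin 2 Er (Set.Ici 0) (Q ℓ) / 2 + 1) * ‖P - P'‖ ^ 2 := by
  have he0 := hH.second_deriv_nonneg hd ℓ
  obtain ⟨ρ, hρ, hE⟩ := hH.exists_energy_near hd ℓ one_pos
  filter_upwards [Metric.ball_mem_nhds P' hρ] with P hP
  rw [Metric.mem_ball, dist_eq_norm] at hP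
  have h1 : |‖P‖ - Q ℓ| ≤ ‖P - P'‖ := hP' ▸ abs_norm_sub_norm_le P P'
  have h2 := (abs_le.1 (hE P (h1.trans_lt hP))).2
  have h3 : (‖P‖ - Q ℓ) ^ 2 ≤ ‖P - P'‖ ^ 2 := sq_le_sq' (abs_le.1 h1).1 (abs_le.1 h1).2
  nlinarith

/-- A minimum of `E` is heavy as soon as the mass is as small as `T ^ (-d / 2)`. -/
theorem isHeavy_of_frequently_mass_le (hH : StandingAssumptions H Er Q Δ n ψ) (hd : 0 < d)
    (h : IsHeatDensity (fun P => infSpec (H P)) N F) {C : ℝ}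
    (hC : ∃ᶠ T in atTop, mass F T ≤ C * (√T ^ d)⁻¹) {P₁ : Momentum d}
    {ℓ : Fin (L + 1)} (hP₁ : ‖P₁‖ = Q ℓ) : IsHeavy F P₁ := by
  intro r hr
  obtain ⟨c, hc, r₁, hr₁, hlow⟩ := h.exists_eventually_le_massOn ((hH.minima P₁).2 ⟨ℓ, hP₁⟩)
    (iteratedDerivWithin 2 Er (Set.Ici 0) (Q ℓ) / 2 + 1)
  have h1 := hlow (min r r₁) (lt_min hr hr₁) (min_le_right _ _) {P₁} (by
    intro P' hP'
    rw [Finset.mem_singleton] at hP'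
    subst hP'
    exact ⟨Metric.mem_ball_self (lt_min hr hr₁), hH.eventually_energy_le hd hP₁⟩)
  have hC0 : 0 < max C 1 := lt_of_lt_of_le one_pos (le_max_right _ _)
  refine ⟨c / max C 1, by positivity, (hC.and_eventually (h1.and (eventually_ge_atTop 0))).mono ?_⟩
  rintro T ⟨h2, h3, hT⟩
  rw [Finset.card_singleton, Nat.cast_one, one_mul] at h3
  refine le_trans ?_ (h.massOn_mono hT (Metric.ball_subset_ball (min_le_left r r₁)))
  refine le_trans ?_ h3
  rw [div_mul_eq_mul_div, div_le_iff₀ hC0, mul_assoc]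
  refine mul_le_mul_of_nonneg_left (h2.trans ?_) hc.le
  rw [mul_comm]
  gcongr
  exact le_max_left _ _

/-- In dimension at least two, a sphere of minima with positive radius contributes more to the mass
than any multiple of `T ^ (-d / 2)`, since it contains infinitely many points. -/
theorem not_frequently_mass_le (hH : StandingAssumptions H Er Q Δ n ψ) (hd : 2 ≤ d)
    (h : IsHeatDensity (fun P => infSpec (H P)) N F) {ℓ : Fin (L + 1)} (hQ : 0 < Q ℓ) (C : ℝ) :
    ¬ ∃ᶠ T in atTop, mass F T ≤ C * (√T ^ d)⁻¹ := by
  intro hC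
  have hd0 : 0 < d := by omega
  obtain ⟨P₁, hP₁⟩ := exists_norm_eq hd0 hQ.le
  obtain ⟨c, hc, r, hr, hlow⟩ := h.exists_eventually_le_massOn ((hH.minima P₁).2 ⟨ℓ, hP₁⟩)
    (iteratedDerivWithin 2 Er (Set.Ici 0) (Q ℓ) / 2 + 1)
  have hinf : (Metric.ball P₁ r ∩ Metric.sphere 0 (Q ℓ)).Infinite := by
    have hrank : 1 < Module.rank ℝ (Momentum d) := by
      rw [← Module.finrank_eq_rank, finrank_euclideanSpace_fin]
      exact_mod_cast hd
    have hmem : P₁ ∈ Metric.sphere (0 : Momentum d) (Q ℓ) := by simpa using hP₁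
    have hP₁0 : P₁ ≠ 0 := by
      rintro rfl; rw [norm_zero] at hP₁; exact hQ.ne hP₁
    have hnt : (Metric.sphere (0 : Momentum d) (Q ℓ)).Nontrivial := by
      refine ⟨P₁, hmem, -P₁, by simpa using hP₁, fun hneg => hP₁0 ?_⟩
      have h2 : (2 : ℝ) • P₁ = 0 := by
        rw [two_smul]
        nth_rewrite 2 [hneg]
        exact add_neg_cancel P₁
      exact (smul_eq_zero.1 h2).resolve_left two_ne_zero
    have hperf := (isPreconnected_sphere hrank 0 (Q ℓ)).preperfect_of_nontrivial hnt
    exact Set.Infinite.of_accPt (hperf.open_inter Metric.isOpen_ball P₁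
      ⟨Metric.mem_ball_self hr, hmem⟩)
  obtain ⟨m, hm⟩ := exists_nat_gt (C / c)
  obtain ⟨s, hs, hcard⟩ := hinf.exists_subset_card_eq m
  have h1 := hlow r hr le_rfl s fun P' hP' => ⟨(hs hP').1,
    hH.eventually_energy_le hd0 (by simpa using (hs hP').2)⟩
  obtain ⟨T, h2, h3, hT⟩ := (hC.and_eventually (h1.and (eventually_gt_atTop 0))).exists
  have h4 := h3.trans ((h.massOn_le_mass hT.le _).trans h2)
  have h5 : 0 < (√T ^ d)⁻¹ := inv_pos.2 (pow_pos (Real.sqrt_pos.2 hT) d)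
  have h6 := le_of_mul_le_mul_right h4 h5
  rw [hcard] at h6
  rw [div_lt_iff₀ hc] at hm
  linarith

/-- If all minima of `E` are heavy and, near each of them, the distance to the sphere is the
distance to the point, then all second derivatives are equal to the diffusion constant. They are
all at least `σ ^ 2`; if one of them were larger, a fixed fraction of the mass would contribute
terms smaller than `exp (-σ² t / 2)` to the characteristic function, and no other part of the mass
could compensate for this. -/
theorem eq_second_deriv (hH : StandingAssumptions H Er Q Δ n ψ) (hd : 0 < d)
    (h : IsHeatDensity (fun P => infSpec (H P)) N F) (hF : DensityCLT F σ)
    (hheavy : ∀ P₁, infSpec (H P₁) = 0 → IsHeavy F P₁) {ρ : ℝ} (hρ : 0 < ρ)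
    (hR : ∀ P₁, infSpec (H P₁) = 0 → ∀ P, ‖P - P₁‖ < ρ → |‖P‖ - ‖P₁‖| = ‖P - P₁‖)
    (ℓ : Fin (L + 1)) : σ ^ 2 = iteratedDerivWithin 2 Er (Set.Ici 0) (Q ℓ) := by
  set e : Fin (L + 1) → ℝ := fun ℓ => iteratedDerivWithin 2 Er (Set.Ici 0) (Q ℓ) with hedef
  have hge : ∀ ℓ, σ ^ 2 ≤ e ℓ := fun ℓ => by
    obtain ⟨P, hP⟩ := exists_norm_eq hd (hH.Q_nonneg' ℓ)
    exact hH.le_second_deriv_of_isHeavy hd h hF hP (hheavy P ((hH.minima P).2 ⟨ℓ, hP⟩))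
  refine le_antisymm (hge ℓ) ?_
  obtain ⟨P₁, hP₁⟩ := exists_norm_eq hd (hH.Q_nonneg' ℓ)
  obtain ⟨r, hr, hiso⟩ := hH.exists_isolated hP₁
  obtain ⟨w, hw, hw1, hup⟩ := h.exp_le_of_isHeavy hF (hheavy P₁ ((hH.minima P₁).2 ⟨ℓ, hP₁⟩)) hr
  obtain ⟨v, hv⟩ := exists_norm_eq hd zero_le_one
  have key : ∀ η : ℝ, 0 < η → Real.exp (-(σ ^ 2 / 2)) ≤
      (1 - w) * Real.exp (-(σ ^ 2 / 2 - η)) + w * Real.exp (-(e ℓ / 2 - η)) := by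
    intro η hη
    have hEn := fun ℓ => hH.exists_energy_near hd ℓ (half_pos hη)
    choose ρ' hρ' hE using hEn
    have := hup v (σ ^ 2 / 2 - η) (e ℓ / 2 - η) 1 (by linarith [hge ℓ]) zero_le_one ?_
    · rw [hv] at this
      convert this using 2 <;> ring_nf
    have hev : ∀ᶠ ε : ℝ in 𝓝[>] 0, ∀ ℓ, ε < ρ' ℓ := eventually_all.2 fun ℓ => by
      filter_upwards [Ioo_mem_nhdsGT (hρ' ℓ)] with ε hε using hε.2
    filter_upwards [hev, Ioo_mem_nhdsGT hρ] with ε hε hε'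
    have hε2 : 0 < ε ^ 2 := pow_pos hε'.1 2
    have hlow : ∀ ℓ' P, ‖P‖ = Q ℓ' → (e ℓ' / 2 - η) * ε ^ 2 < infSpec (H (P + ε • v)) := by
      intro ℓ' P hP
      have h1 : ‖P + ε • v - P‖ = ε := by
        rw [add_sub_cancel_left, norm_smul, hv, mul_one, Real.norm_of_nonneg hε'.1.le]
      have h2 := hR P ((hH.minima P).2 ⟨ℓ', hP⟩) (P + ε • v) (by rw [h1]; exact hε'.2)
      rw [h1, hP] at h2
      have h3 := (abs_le.1 (hE ℓ' (P + ε • v) (by rw [h2]; exact hε ℓ'))).1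
      rw [← sq_abs, h2] at h3
      change -(η / 2 * ε ^ 2) ≤ infSpec (H (P + ε • v)) - e ℓ' / 2 * ε ^ 2 at h3
      nlinarith
    refine ⟨fun P hP => ?_, fun P hP hP0 => hlow ℓ P (hiso P hP hP0)⟩
    obtain ⟨ℓ', hℓ'⟩ := (hH.minima P).1 hP
    have h4 := hlow ℓ' P hℓ'
    have h5 := hge ℓ'
    refine lt_of_le_of_lt ?_ h4
    gcongr
  have hlim : Tendsto (fun η : ℝ => (1 - w) * Real.exp (-(σ ^ 2 / 2 - η)) +
      w * Real.exp (-(e ℓ / 2 - η))) (𝓝[>] 0)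
      (𝓝 ((1 - w) * Real.exp (-(σ ^ 2 / 2 - 0)) + w * Real.exp (-(e ℓ / 2 - 0)))) :=
    (Continuous.tendsto (by fun_prop) 0).mono_left nhdsWithin_le_nhds
  have h1 := ge_of_tendsto hlim (by
    filter_upwards [self_mem_nhdsWithin] with η hη using key η hη)
  rw [sub_zero, sub_zero] at h1
  have h2 : w * Real.exp (-(σ ^ 2 / 2)) ≤ w * Real.exp (-(e ℓ / 2)) := by linarith
  have h3 := Real.exp_le_exp.1 (le_of_mul_le_mul_left h2 hw)
  linarith

end StandingAssumptions

end Energy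

/-- On the line, two points closer to each other than one of them is to the origin lie on the same
side of the origin. -/
theorem abs_norm_sub_norm_eq_of_dim_one (P P₁ : Momentum 1) (h : ‖P - P₁‖ < ‖P₁‖) :
    |‖P‖ - ‖P₁‖| = ‖P - P₁‖ := by
  have hn : ∀ R : Momentum 1, ‖R‖ = |R 0| := fun R => by
    rw [EuclideanSpace.norm_eq, Fin.sum_univ_one, Real.norm_eq_abs, sq_abs, Real.sqrt_sq_eq_abs]
  rw [hn, hn] at h
  rw [hn, hn, hn]
  simp only [PiLp.sub_apply] at h ⊢
  grind

end FiberCLT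

end

theorem mainTheorem3 {d L : ℕ} {𝓗 𝔥 : Type*}
    [NormedAddCommGroup 𝓗] [InnerProductSpace ℂ 𝓗] [CompleteSpace 𝓗]
    [NormedAddCommGroup 𝔥] [InnerProductSpace ℂ 𝔥] [CompleteSpace 𝔥]
    (V : 𝓗 ≃ₗᵢ[ℂ] Lp 𝔥 2 (volume : Measure (FiberCLT.Momentum d)))
    (H : FiberCLT.Momentum d → 𝔥 →ₗ.[ℂ] 𝔥) (Er : ℝ → ℝ)
    (Q : Fin (L + 1) → ℝ) (Δ : Fin (L + 1) → Set ℝ) (n : Fin (L + 1) → ℕ)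
    (ψ : FiberCLT.Momentum d → 𝔥)
    (hH : FiberCLT.StandingAssumptions H Er Q Δ n ψ)
    (φ : 𝓗) (hφ : FiberCLT.IsAdmissible V Q Δ ψ φ)
    (σ : ℝ) (hσ : 0 < σ) (hCLT : FiberCLT.TwoSidedCLT V H φ σ) :
    (2 ≤ d →
      Q 0 = 0 ∧
      σ ^ 2 = iteratedDerivWithin 2 Er (Set.Ici 0) 0 ∧
      ∀ P : FiberCLT.Momentum d, P ≠ 0 →
        FiberCLT.infSpec (H 0) < FiberCLT.infSpec (H P)) ∧
    (d = 1 → ∀ ℓ, σ ^ 2 = iteratedDerivWithin 2 Er (Set.Ici 0) (Q ℓ)) := by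
  have hF := hH.densityCLT hCLT
  refine ⟨fun hd => ?_, fun hd ℓ => ?_⟩
  · have hd0 : 0 < d := by omega
    have h := hH.isHeatDensity hφ hd0
    obtain ⟨P₀, hP₀, hh⟩ := h.exists_isHeavy
    obtain ⟨ℓ, hℓ⟩ := (hH.minima P₀).1 hP₀
    have hQℓ : Q ℓ = 0 := by
      by_contra hne
      exact hH.not_isHeavy_of_pos hd h hσ hF hℓ
        (lt_of_le_of_ne (hH.Q_nonneg' ℓ) (Ne.symm hne)) hh
    have hP₀0 : P₀ = 0 := by rw [← norm_eq_zero, hℓ, hQℓ]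
    obtain ⟨C, hC⟩ := hH.exists_frequently_mass_le hd0 h hσ hF hℓ hh one_pos
      (by intro P _; rw [hP₀0, norm_zero, sub_zero, sub_zero, abs_norm])
    have hQ : ∀ ℓ', Q ℓ' = 0 := by
      intro ℓ'
      by_contra hne
      exact hH.not_frequently_mass_le hd h (lt_of_le_of_ne (hH.Q_nonneg' ℓ') (Ne.symm hne)) C hC
    have hzero : ∀ P, FiberCLT.infSpec (H P) = 0 ↔ P = 0 := by
      intro P
      rw [hH.minima, ← norm_eq_zero]
      exact ⟨fun ⟨ℓ', h'⟩ => h'.trans (hQ ℓ'), fun h' => ⟨0, h'.trans (hQ 0).symm⟩⟩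
    have heq : σ ^ 2 = iteratedDerivWithin 2 Er (Set.Ici 0) (Q 0) := by
      refine hH.eq_second_deriv hd0 h hF (fun P₁ hP₁ => ?_) one_pos (fun P₁ hP₁ P _ => ?_) 0
      · rw [(hzero P₁).1 hP₁, ← hP₀0]
        exact hh
      · rw [(hzero P₁).1 hP₁, norm_zero, sub_zero, sub_zero, abs_norm]
    refine ⟨hQ 0, by rwa [hQ 0] at heq, fun P hP => ?_⟩
    rw [(hzero 0).2 rfl]
    exact lt_of_le_of_ne (hH.infSpec_nonneg P) fun h0 => hP ((hzero P).1 h0.symm)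
  · subst hd
    have h := hH.isHeatDensity hφ one_pos
    obtain ⟨ρ, hρ, hρQ⟩ : ∃ ρ : ℝ, 0 < ρ ∧ ∀ ℓ', Q ℓ' ≠ 0 → ρ ≤ Q ℓ' := by
      have : ∀ᶠ ρ : ℝ in 𝓝[>] 0, ∀ ℓ', Q ℓ' ≠ 0 → ρ ≤ Q ℓ' := by
        refine eventually_all.2 fun ℓ' => ?_
        by_cases hne : Q ℓ' = 0
        · exact Eventually.of_forall fun _ h' => absurd hne h'
        filter_upwards [Ioo_mem_nhdsGT (lt_of_le_of_ne (hH.Q_nonneg' ℓ') (Ne.symm hne))]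
          with ρ hρ _ using hρ.2.le
      obtain ⟨ρ, h1, h2⟩ := (this.and self_mem_nhdsWithin).exists
      exact ⟨ρ, h2, h1⟩
    have hR : ∀ P₁, FiberCLT.infSpec (H P₁) = 0 → ∀ P, ‖P - P₁‖ < ρ →
        |‖P‖ - ‖P₁‖| = ‖P - P₁‖ := by
      intro P₁ hP₁ P hP
      obtain ⟨ℓ', hℓ'⟩ := (hH.minima P₁).1 hP₁
      by_cases hne : Q ℓ' = 0
      · have : P₁ = 0 := by rw [← norm_eq_zero, hℓ', hne]
        rw [this, norm_zero, sub_zero, sub_zero, abs_norm]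
      · exact FiberCLT.abs_norm_sub_norm_eq_of_dim_one P P₁
          (hP.trans_le ((hρQ ℓ' hne).trans_eq hℓ'.symm))
    obtain ⟨P₀, hP₀, hh⟩ := h.exists_isHeavy
    obtain ⟨ℓ₀, hℓ₀⟩ := (hH.minima P₀).1 hP₀
    obtain ⟨C, hC⟩ := hH.exists_frequently_mass_le one_pos h hσ hF hℓ₀ hh hρ (hR P₀ hP₀)
    refine hH.eq_second_deriv one_pos h hF (fun P₁ hP₁ => ?_) hρ hR ℓ
    obtain ⟨ℓ₁, hℓ₁⟩ := (hH.minima P₁).1 hP₁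
    exact hH.isHeavy_of_frequently_mass_le one_pos h hC hℓ₁
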